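/- All graphs are finite. A graph $G$ is $(t_1,t_2)$-Ramsey if every coloring of its edges in red and blue contains a red copy of $K_{t_1}$ or a blue copy of $K_{t_2}$. The Ramsey number $r(t_1,t_2)$ is the smallest $n$ such that $K_n$ is $(t_1,t_2)$-Ramsey, and for a graph $F$ the $F$-Ramsey number $r_F(t_1,t_2)$ is the smallest number of (unlabelled) copies of $F$ in a $(t_1,t_2)$-Ramsey graph. For real $x$ and an integer $s\ge 0$ write $\binom{x}{s}=x(x-1)\cdots(x-s+1)/s!$. **Theorem.** (1) There are an absolute constant $c>0$ and an integer $T$ such that for all integers $t\ge T$ and all integers $0\le s\le t$, every $(4,t)$-Ramsey graph contains at least $$\binom{c\,t^3/\log^4 t}{s}$$ copies of $K_s$; moreover $r_{K_s}(4,t)=\binom{x}{s}$ for some real $x\ge c\,t^3/\log^4 t$ (which may depend on $s$ and $t$). That is, $r_{K_s}(4,t)=\binom{\Omega(t^3/\log^4 t)}{s}$, with an absolute implicit constant. (2) Consequently $r_{K_s}(4,t)=\binom{r(4,t)}{s}^{1-o(1)}$, where the $o(1)$ term tends to $0$ as $t\to\infty$ uniformly in $s$: there are a function $\delta(t)$ with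 $\delta(t)\to 0$ as $t\to\infty$ and an integer $T'$ such that for all integers $t\ge T'$ and all integers $0\le s\le t$ there is a real $\varepsilon$ with $0\le\varepsilon\le\delta(t)$ and $$r_{K_s}(4,t)=\binom{r(4,t)}{s}^{1-\varepsilon}.$$ -/

import Mathlib

/-- A graph `G` is `(t₁, t₂)`-Ramsey if every colouring of its edges in red (`true`) and blue
(`false`) contains a red copy of `K_{t₁}` or a blue copy of `K_{t₂}`. -/
def IsRamseyGraph {V : Type*} (G : SimpleGraph V) (t₁ t₂ : ℕ) : Prop :=
  ∀ C : G.EdgeLabeling Bool,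
    ¬ (C.labelGraph true).CliqueFree t₁ ∨ ¬ (C.labelGraph false).CliqueFree t₂

/-- The Ramsey number `r(t₁, t₂)`: the smallest `n` such that `K_n` is `(t₁, t₂)`-Ramsey. -/
noncomputable def ramseyNumber (t₁ t₂ : ℕ) : ℕ :=
  sInf {n : ℕ | IsRamseyGraph (SimpleGraph.completeGraph (Fin n)) t₁ t₂}

/-- The `F`-Ramsey number `r_F(t₁, t₂)`: the smallest number of (unlabelled) copies of `F`
contained in a finite `(t₁, t₂)`-Ramsey graph. -/
noncomputable def graphRamseyNumber {W : Type*} (F : SimpleGraph W) (t₁ t₂ : ℕ) : ℕ :=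
  sInf {N : ℕ | ∃ (n : ℕ) (G : SimpleGraph (Fin n)), IsRamseyGraph G t₁ t₂ ∧ G.copyCount F = N}

/-! Let `G` be a graph. It suffices to produce `binom(k,t)` copies of `K_t`, with `k` of order `t^3
/ log^4 t`, in every `(4,t)`-Ramsey `G`: Kruskal–Katona (`choose_le_card_cliqueFinset`) then gives
`binom(k,s)` copies of `K_s` for every `s ≤ t`. Take the about `q^4` nonvertical secants of the
affine Hermitian unital (at most `q^3` points, `q + 1` on each secant). Colour the secants through
each point randomly with two colours, and join two secants if they meet at a point where their
colours differ. No three concurrent secants are pairwise joined, and among four pairwise meeting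
secants three are concurrent (`hermitian_onan`), so this random graph has no `K_4`. Map the vertices
of `G` to secants at random and colour an edge red if its ends go to joined secants, blue otherwise.
If the expected number of blue `t`-cliques is below 1, `G` is not Ramsey
(`not_isRamseyGraph_of_card_lt`). That expectation is governed by the weighted count of independent
sets of secants, `weightGen`. While the remaining mass exceeds `64 q^2`, some secant has the
property that putting it into the set multiplies the mass by at most `1 - 1/(64q)`
(`exists_mass_union_le`, by Cauchy–Schwarz). So only `R = O(q log q)` such choices are possible, and
they cost a factor `(n+1)^R` (`weightGen_le`), where `n` is the number of secants. With `q` about `t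
/ log^2 t` this factor is `exp(O(t))`, and `n^t` divided by the remaining bound is at least
`binom(k,t)`. Part (2) compares `binom(k,s) ≤ r_{K_s}(4,t) ≤ binom(r,s)` with `r = r(4,t) ≤
(t+2)^3`: the two ends differ by a factor at most `(C log^4 t)^s`, whereas `binom(r,s) ≥ t^s`. -/

/-! ### The affine Hermitian unital -/

open Polynomial in
/-- The equation `y + y ^ q = c` has at most `q` solutions in a field. -/
theorem card_filter_add_pow_le {K : Type*} [Field K] [Fintype K] [DecidableEq K] {q : ℕ}
    (hq : 2 ≤ q) (c : K) : (Finset.univ.filter fun y : K ↦ y + y ^ q = c).card ≤ q := by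
  have hdeg : (X ^ q + (X - C c) : K[X]).natDegree = q := by
    rw [natDegree_add_eq_left_of_natDegree_lt, natDegree_X_pow]
    rw [natDegree_X_pow, natDegree_X_sub_C]; omega
  have h0 : (X ^ q + (X - C c) : K[X]) ≠ 0 := by
    intro h; rw [h] at hdeg; simp at hdeg; omega
  calc _ ≤ (X ^ q + (X - C c) : K[X]).roots.toFinset.card := by
        refine Finset.card_le_card fun y hy ↦ ?_
        simp only [Finset.mem_filter, Finset.mem_univ, true_and] at hy
        rw [Multiset.mem_toFinset, mem_roots h0]
        simp only [IsRoot.def, eval_add, eval_pow, eval_X, eval_sub, eval_C]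
        rw [← hy]; ring
    _ ≤ _ := (Multiset.toFinset_card_le _).trans ((card_roots' _).trans hdeg.le)

/-- Serves twice: to bound the number of points of the unital and the number of its nonvertical
tangents. -/
theorem card_filter_prod_add_pow_le {K : Type*} [Field K] [Fintype K] [DecidableEq K] {q : ℕ}
    (hq : 2 ≤ q) (f : K → K) :
    (Finset.univ.filter fun z : K × K ↦ z.2 + z.2 ^ q = f z.1).card ≤ Fintype.card K * q := by
  classical
  rw [Finset.card_eq_sum_card_fiberwise (f := Prod.fst) (t := Finset.univ) (fun _ _ ↦ by simp)]
  calc _ ≤ ∑ _x : K, q := Finset.sum_le_sum fun x _ ↦ ?_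
    _ = _ := by simp
  refine le_trans ?_ (card_filter_add_pow_le hq (f x))
  refine Finset.card_le_card_of_injOn Prod.snd ?_ ?_
  · rintro ⟨a, b⟩ h; simp only [Finset.coe_filter, Finset.mem_filter, Finset.mem_univ, true_and, Set.mem_ofPred_eq] at h ⊢
    rw [← h.2]; exact h.1
  · rintro ⟨a, b⟩ h ⟨a', b'⟩ h' e
    simp only [Finset.coe_filter, Finset.mem_filter, Finset.mem_univ, true_and, Set.mem_ofPred_eq] at h h' e
    rw [Prod.mk.injEq]; exact ⟨h.2.trans h'.2.symm, e⟩

/-- The norm equation over a field with `q ^ 2` elements. -/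
theorem card_filter_pow_succ_eq {K : Type*} [Field K] [Fintype K] [DecidableEq K] {q : ℕ}
    (hq : 2 ≤ q) (hK : Fintype.card K = q ^ 2) {c : K} (hc : c ≠ 0) (hcq : c ^ q = c) :
    (Finset.univ.filter fun x : K ↦ x ^ (q + 1) = c).card = q + 1 := by
  obtain ⟨r, rfl⟩ : ∃ r, q = r + 1 := ⟨q - 1, by omega⟩
  obtain ⟨g, hg⟩ := IsCyclic.exists_generator (α := Kˣ)
  have hord : orderOf g = (r + 1 + 1) * r := by
    rw [orderOf_eq_card_of_forall_mem_zpowers hg, Nat.card_eq_fintype_card, Fintype.card_units, hK]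
    have : (r + 1) ^ 2 = (r + 1 + 1) * r + 1 := by ring
    omega
  have hprim : IsPrimitiveRoot (((g ^ r : Kˣ) : K)) (r + 1 + 1) := by
    rw [IsPrimitiveRoot.coe_units_iff]
    refine (hord ▸ IsPrimitiveRoot.orderOf g).pow (Nat.mul_pos (by omega) (by omega)) (by ring)
  -- `c` has order dividing `q - 1` in a cyclic group of order `(q + 1)(q - 1)`, so it is a `(q +
  -- 1)`-th power.
  have hex : ∃ α : K, α ^ (r + 1 + 1) = c := by
    obtain ⟨i, hi⟩ := (Subgroup.mem_zpowers_iff).1 (hg (Units.mk0 c hc))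
    have h1 : (Units.mk0 c hc) ^ r = 1 := by
      apply Units.ext
      simp only [Units.val_pow_eq_pow_val, Units.val_mk0, Units.val_one]
      exact mul_right_cancel₀ hc (by rw [one_mul, ← pow_succ, hcq])
    rw [← hi, ← zpow_natCast, ← zpow_mul, ← orderOf_dvd_iff_zpow_eq_one, hord] at h1
    push_cast at h1
    obtain ⟨j, hj⟩ := (mul_dvd_mul_iff_right (by exact_mod_cast (by omega : r ≠ 0) : (r : ℤ) ≠ 0)).1 h1
    refine ⟨((g ^ j : Kˣ) : K), ?_⟩
    have : (g ^ j) ^ (r + 1 + 1) = Units.mk0 c hc := by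
      rw [← hi, hj, ← zpow_natCast, ← zpow_mul]; congr 1; push_cast; ring
    simpa using congrArg Units.val this
  have h := hprim.card_nthRoots c
  rw [if_pos hex] at h
  refine Eq.trans ?_ ((Multiset.toFinset_card_of_nodup (hprim.nthRoots_nodup hc)).trans h)
  congr 1; ext x; simp [Polynomial.mem_nthRoots]

/-! ### Absence of O'Nan configurations -/

/-- The determinant of the Gram matrix of three isotropic vectors of a Hermitian form. -/
theorem hermitian_gram_identity {K : Type*} [CommRing K] (x₁ x₂ x₃ y₁ y₂ y₃ u₁ u₂ u₃ v₁ v₂ v₃ : K)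
    (h₁ : y₁ + v₁ = x₁ * u₁) (h₂ : y₂ + v₂ = x₂ * u₂) (h₃ : y₃ + v₃ = x₃ * u₃) :
    (y₁ + v₂ - x₁ * u₂) * (y₂ + v₃ - x₂ * u₃) * (y₃ + v₁ - x₃ * u₁)
      + (y₂ + v₁ - x₂ * u₁) * (y₃ + v₂ - x₃ * u₂) * (y₁ + v₃ - x₁ * u₃)
    = (x₁ * (y₂ - y₃) + x₂ * (y₃ - y₁) + x₃ * (y₁ - y₂))
      * (u₁ * (v₂ - v₃) + u₂ * (v₃ - v₁) + u₃ * (v₁ - v₂)) := by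
  obtain rfl : v₁ = x₁ * u₁ - y₁ := by rw [← h₁]; ring
  obtain rfl : v₂ = x₂ * u₂ - y₂ := by rw [← h₂]; ring
  obtain rfl : v₃ = x₃ * u₃ - y₃ := by rw [← h₃]; ring
  ring

/-- Two isotropic points and a third one on the line through them. -/
theorem isotropic_on_secant {K : Type*} [CommRing K] {a b a' b' x₁ x₂ f u₁ u₂ g : K}
    (h₁ : a * x₁ + b + (a' * u₁ + b') = x₁ * u₁) (h₂ : a * x₂ + b + (a' * u₂ + b') = x₂ * u₂)
    (hf : a * f + b + (a' * g + b') = f * g) :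
    (f - x₂) * (u₁ - g) * ((a * x₁ + b) + (a' * u₂ + b') - x₁ * u₂)
      + (g - u₂) * (x₁ - f) * ((a * x₂ + b) + (a' * u₁ + b') - x₂ * u₁) = 0 := by
  linear_combination (x₁ - x₂) * (u₁ - u₂) * hf - (f - x₂) * (g - u₂) * h₁
    - (x₁ - f) * (u₁ - g) * h₂

/-- Menelaus' theorem for four nonvertical lines of the affine plane. -/
theorem menelaus_of_lines {K : Type*} [Field K] {a b c d a' b' c' d' x₁ x₂ x₃ f₁ f₂ f₃ : K}
    (hab : a ≠ b) (hac : a ≠ c) (had : a ≠ d) (hbc : b ≠ c) (hbd : b ≠ d) (hcd : c ≠ d)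
    (h₁ : b * x₁ + b' = c * x₁ + c') (h₂ : c * x₂ + c' = a * x₂ + a')
    (h₃ : a * x₃ + a' = b * x₃ + b') (k₁ : a * f₁ + a' = d * f₁ + d')
    (k₂ : b * f₂ + b' = d * f₂ + d') (k₃ : c * f₃ + c' = d * f₃ + d') :
    (f₃ - x₂) * (f₁ - x₃) * (f₂ - x₁) = (f₃ - x₁) * (f₁ - x₂) * (f₂ - x₃) := by
  have e₁ : x₁ = (c' - b') / (b - c) := by
    rw [eq_div_iff (sub_ne_zero.2 hbc)]; linear_combination h₁
  have e₂ : x₂ = (a' - c') / (c - a) := by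
    rw [eq_div_iff (sub_ne_zero.2 hac.symm)]; linear_combination h₂
  have e₃ : x₃ = (b' - a') / (a - b) := by
    rw [eq_div_iff (sub_ne_zero.2 hab)]; linear_combination h₃
  have l₁ : f₁ = (d' - a') / (a - d) := by
    rw [eq_div_iff (sub_ne_zero.2 had)]; linear_combination k₁
  have l₂ : f₂ = (d' - b') / (b - d) := by
    rw [eq_div_iff (sub_ne_zero.2 hbd)]; linear_combination k₂
  have l₃ : f₃ = (d' - c') / (c - d) := by
    rw [eq_div_iff (sub_ne_zero.2 hcd)]; linear_combination k₃
  have p₁ := sub_ne_zero.2 hab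
  have p₂ := sub_ne_zero.2 hac.symm
  have p₃ := sub_ne_zero.2 had
  have p₄ := sub_ne_zero.2 hbc
  have p₅ := sub_ne_zero.2 hbd
  have p₆ := sub_ne_zero.2 hcd
  rw [e₁, e₂, e₃, l₁, l₂, l₃]
  field_simp
  ring

/-- The affine Hermitian curve `y + σ y = x * σ x` contains no O'Nan configuration: if four
nonvertical lines meet pairwise on the curve, three of the meeting points on one of them coincide. -/
theorem hermitian_onan {K : Type*} [Field K] (σ : K →+* K)
    {a b c d a' b' c' d' x₁ x₂ x₃ f₁ f₂ f₃ : K}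
    (hab : a ≠ b) (hac : a ≠ c) (had : a ≠ d) (hbc : b ≠ c) (hbd : b ≠ d) (hcd : c ≠ d)
    (h₁ : b * x₁ + b' = c * x₁ + c') (h₂ : c * x₂ + c' = a * x₂ + a')
    (h₃ : a * x₃ + a' = b * x₃ + b') (k₁ : a * f₁ + a' = d * f₁ + d')
    (k₂ : b * f₂ + b' = d * f₂ + d') (k₃ : c * f₃ + c' = d * f₃ + d')
    (i₁ : b * x₁ + b' + σ (b * x₁ + b') = x₁ * σ x₁)
    (i₂ : c * x₂ + c' + σ (c * x₂ + c') = x₂ * σ x₂)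
    (i₃ : a * x₃ + a' + σ (a * x₃ + a') = x₃ * σ x₃)
    (j₁ : a * f₁ + a' + σ (a * f₁ + a') = f₁ * σ f₁)
    (j₂ : b * f₂ + b' + σ (b * f₂ + b') = f₂ * σ f₂)
    (j₃ : c * f₃ + c' + σ (c * f₃ + c') = f₃ * σ f₃) :
    x₁ = x₂ ∨ x₁ = x₃ ∨ f₃ = x₂ ∨ f₁ = x₃ ∨ f₂ = x₁ := by
  by_contra! hne
  obtain ⟨n₁, n₂, n₃, n₄, n₅⟩ := hne
  have hM := menelaus_of_lines hab hac had hbc hbd hcd h₁ h₂ h₃ k₁ k₂ k₃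
  have hM' := congrArg σ hM
  have i₁' := i₁; have i₂' := i₂; have i₃' := i₃
  rw [h₁] at i₁'; rw [h₂] at i₂'; rw [h₃] at i₃'
  simp only [map_add, map_mul, map_sub] at *
  -- On each side of the triangle the third isotropic point fixes the ratio of two conjugate Gram
  -- entries. Multiplying the three relations and cancelling by Menelaus and its conjugate makes the
  -- Gram determinant vanish, although it equals `Δ * σ Δ` with `Δ ≠ 0` for a genuine triangle.
  have A := isotropic_on_secant i₁' i₂ j₃
  have B := isotropic_on_secant i₂' i₃ j₁
  have C := isotropic_on_secant i₃' i₁ j₂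
  have hG := hermitian_gram_identity _ _ _ _ _ _ _ _ _ _ _ _ i₁ i₂ i₃
  have h₁' := congrArg σ h₁
  have h₂' := congrArg σ h₂
  have h₃' := congrArg σ h₃
  simp only [map_add, map_mul] at h₁' h₂' h₃'
  rw [← h₁, ← h₁'] at A
  rw [← h₂, ← h₂'] at B
  rw [← h₃, ← h₃'] at C
  set v₁ := σ b * σ x₁ + σ b'
  set v₂ := σ c * σ x₂ + σ c'
  set v₃ := σ a * σ x₃ + σ a'
  have hΔ : x₁ * ((c * x₂ + c') - (a * x₃ + a')) + x₂ * ((a * x₃ + a') - (b * x₁ + b'))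
      + x₃ * ((b * x₁ + b') - (c * x₂ + c')) = (x₁ - x₂) * (x₁ - x₃) * (b - c) := by
    linear_combination -(x₁ - x₂) * h₃ - (x₁ - x₃) * h₁
  have hΔ' : σ x₁ * (v₂ - v₃) + σ x₂ * (v₃ - v₁) + σ x₃ * (v₁ - v₂)
      = (σ x₁ - σ x₂) * (σ x₁ - σ x₃) * (σ b - σ c) := by
    linear_combination -(σ x₁ - σ x₂) * h₃' - (σ x₁ - σ x₃) * h₁'
  rw [hΔ, hΔ'] at hG
  have hD : ((f₃ - x₂) * (f₁ - x₃) * (f₂ - x₁))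
      * ((σ f₃ - σ x₂) * (σ f₁ - σ x₃) * (σ f₂ - σ x₁))
      * (((x₁ - x₂) * (x₁ - x₃) * (b - c))
      * ((σ x₁ - σ x₂) * (σ x₁ - σ x₃) * (σ b - σ c))) = 0 := by
    rw [← hG]
    have hprod : ∀ {p q r p' q' r' : K}, p + p' = 0 → q + q' = 0 → r + r' = 0 →
        p * q * r + p' * q' * r' = 0 := by
      intro p q r p' q' r' hp hq hr
      linear_combination q * r * hp - p' * r * hq + p' * q' * hr
    have h := hprod A B C
    generalize b * x₁ + b' = y₁ at *
    generalize c * x₂ + c' = y₂ at *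
    generalize a * x₃ + a' = y₃ at *
    generalize y₁ + v₂ - x₁ * σ x₂ = m₁ at *
    generalize y₂ + v₃ - x₂ * σ x₃ = m₂ at *
    generalize y₃ + v₁ - x₃ * σ x₁ = m₃ at *
    generalize y₂ + v₁ - x₂ * σ x₁ = m₄ at *
    generalize y₃ + v₂ - x₃ * σ x₂ = m₅ at *
    generalize y₁ + v₃ - x₁ * σ x₃ = m₆ at *
    linear_combination -h + (f₃ - x₂) * (f₁ - x₃) * (f₂ - x₁) * (m₁ * m₂ * m₃) * hM'
      + (σ f₃ - σ x₂) * (σ f₁ - σ x₃) * (σ f₂ - σ x₁) * (m₄ * m₅ * m₆) * hM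
  have inj : ∀ {x y : K}, x ≠ y → σ x - σ y ≠ 0 := fun h ↦ sub_ne_zero.2 (σ.injective.ne h)
  refine absurd hD ?_
  simp only [mul_ne_zero_iff, ne_eq]
  exact ⟨⟨⟨⟨sub_ne_zero.2 n₃, sub_ne_zero.2 n₄⟩, sub_ne_zero.2 n₅⟩, ⟨inj n₃, inj n₄⟩, inj n₅⟩,
    ⟨⟨sub_ne_zero.2 n₁, sub_ne_zero.2 n₂⟩, sub_ne_zero.2 hbc⟩, ⟨inj n₁, inj n₂⟩, inj hbc⟩

/-- A finite partial linear space with lines of size `q + 1` in which any four lines that meet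
pairwise contain three concurrent ones. -/
structure IsONanFree {P L : Type} [DecidableEq P] (inc : L → Finset P) (q : ℕ) : Prop where
  card_inc : ∀ l, (inc l).card = q + 1
  card_inter_le : ∀ l m, l ≠ m → (inc l ∩ inc m).card ≤ 1
  -- Each of the five coincidences places one point on three of the four lines.
  onan : ∀ a b c d : L, a ≠ b → a ≠ c → a ≠ d → b ≠ c → b ≠ d → c ≠ d →
    ∀ p₁ p₂ p₃ q₁ q₂ q₃ : P, p₁ ∈ inc b ∩ inc c → p₂ ∈ inc c ∩ inc a → p₃ ∈ inc a ∩ inc b →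
      q₁ ∈ inc a ∩ inc d → q₂ ∈ inc b ∩ inc d → q₃ ∈ inc c ∩ inc d →
      p₁ = p₂ ∨ p₁ = p₃ ∨ q₃ = p₂ ∨ q₁ = p₃ ∨ q₂ = p₁

/-- The points of the affine Hermitian unital and its nonvertical secants. -/
theorem exists_isONanFree (q : ℕ) [hp : Fact q.Prime] :
    ∃ (P L : Type) (_ : Fintype P) (_ : Fintype L) (_ : DecidableEq P) (_ : DecidableEq L)
      (inc : L → Finset P), IsONanFree inc q ∧ Fintype.card P ≤ q ^ 3 ∧
      q ^ 4 ≤ Fintype.card L + q ^ 3 ∧ Fintype.card L ≤ q ^ 4 := by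
  classical
  have hq : 2 ≤ q := hp.out.two_le
  let K := GaloisField q 2
  have : Fintype K := Fintype.ofFinite K
  have hK : Fintype.card K = q ^ 2 := by
    rw [← Nat.card_eq_fintype_card]; exact GaloisField.card q 2 (by norm_num)
  let σ : K →+* K := frobenius K q
  have hσ : ∀ x, σ x = x ^ q := fun x ↦ rfl
  have hσσ : ∀ x, σ (σ x) = x := fun x ↦ by
    rw [hσ, hσ, ← pow_mul, ← sq, ← hK, FiniteField.pow_card]
  let P := {z : K × K // z.2 + z.2 ^ q = z.1 ^ (q + 1)}
  -- A pair is (slope, intercept); the excluded lines are the tangents.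
  let L := {z : K × K // z.2 + z.2 ^ q ≠ - z.1 ^ (q + 1)}
  let inc : L → Finset P := fun l ↦ Finset.univ.filter fun p ↦ p.1.2 = l.1.1 * p.1.1 + l.1.2
  have hinc : ∀ {l : L} {p : P}, p ∈ inc l ↔ p.1.2 = l.1.1 * p.1.1 + l.1.2 := by
    intro l p; simp [inc]
  have hslope : ∀ {l m : L} {p : P}, l ≠ m → p ∈ inc l → p ∈ inc m → l.1.1 ≠ m.1.1 := by
    intro l m p hlm h₁ h₂ h
    rw [hinc] at h₁ h₂
    refine hlm (Subtype.ext (Prod.ext h ?_))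
    rw [h₁, h] at h₂; exact add_left_cancel h₂
  have hxext : ∀ {l : L} {p r : P}, p ∈ inc l → r ∈ inc l → p.1.1 = r.1.1 → p = r := by
    intro l p r h₁ h₂ h
    rw [hinc] at h₁ h₂
    exact Subtype.ext (Prod.ext h (by rw [h₁, h₂, h]))
  refine ⟨P, L, inferInstance, inferInstance, inferInstance, inferInstance, inc, ⟨?_, ?_, ?_⟩, ?_, ?_, ?_⟩
  · intro l
    set c := l.1.2 + l.1.2 ^ q + l.1.1 ^ (q + 1) with hc
    have hc0 : c ≠ 0 := fun h ↦ l.2 (eq_neg_of_add_eq_zero_left h)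
    have hcq : c ^ q = c := by
      rw [← hσ, hc]; simp only [← hσ, pow_succ', map_add, map_mul, hσσ]; ring
    rw [← card_filter_pow_succ_eq hq hK hc0 hcq]
    -- Completing the Hermitian square: intersection points correspond to elements of norm `c`, and
    -- `c ≠ 0` because the line is not tangent.
    have key : ∀ x : K, (x - σ l.1.1) ^ (q + 1) = c ↔
        (l.1.1 * x + l.1.2) + (l.1.1 * x + l.1.2) ^ q = x ^ (q + 1) := by
      intro x
      rw [hc]; simp only [pow_succ', ← hσ, map_add, map_mul, map_sub, hσσ]
      constructor <;> intro h <;> linear_combination -h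
    refine Finset.card_bij (fun p _ ↦ p.1.1 - σ l.1.1) ?_ ?_ ?_
    · intro p hp
      rw [hinc] at hp
      simp only [Finset.mem_filter, Finset.mem_univ, true_and, key]
      rw [← hp]; exact p.2
    · intro p hp r hr h
      exact hxext hp hr (sub_left_injective h)
    · intro x hx
      simp only [Finset.mem_filter, Finset.mem_univ, true_and] at hx
      have hx' := (key (x + σ l.1.1)).1 (by rwa [add_sub_cancel_right])
      exact ⟨⟨(x + σ l.1.1, l.1.1 * (x + σ l.1.1) + l.1.2), hx'⟩, by rw [hinc], by simp⟩
  · intro l m hlm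
    rw [Finset.card_le_one]
    intro p hp r hr
    rw [Finset.mem_inter] at hp hr
    refine hxext hp.1 hr.1 ?_
    have hs := hslope hlm hp.1 hp.2
    rw [hinc, hinc] at hp hr
    refine mul_left_cancel₀ (sub_ne_zero.2 hs) ?_
    linear_combination hp.2 - hp.1 + hr.1 - hr.2
  · intro a b c d hab hac had hbc hbd hcd p₁ p₂ p₃ q₁ q₂ q₃ h₁ h₂ h₃ k₁ k₂ k₃
    rw [Finset.mem_inter] at h₁ h₂ h₃ k₁ k₂ k₃
    have e : ∀ {l m : L} {p : P}, p ∈ inc l → p ∈ inc m →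
        l.1.1 * p.1.1 + l.1.2 = m.1.1 * p.1.1 + m.1.2 := by
      intro l m p h h'
      rw [hinc] at h h'; rw [← h, ← h']
    have i : ∀ {l : L} {p : P}, p ∈ inc l →
        l.1.1 * p.1.1 + l.1.2 + σ (l.1.1 * p.1.1 + l.1.2) = p.1.1 * σ p.1.1 := by
      intro l p h
      rw [hinc] at h; rw [← h, hσ, hσ, p.2, pow_succ']
    have := hermitian_onan σ (hslope hab h₃.1 h₃.2) (hslope hac h₂.2 h₂.1) (hslope had k₁.1 k₁.2)
      (hslope hbc h₁.1 h₁.2) (hslope hbd k₂.1 k₂.2) (hslope hcd k₃.1 k₃.2) (e h₁.1 h₁.2)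
      (e h₂.1 h₂.2) (e h₃.1 h₃.2) (e k₁.1 k₁.2) (e k₂.1 k₂.2) (e k₃.1 k₃.2)
      (i h₁.1) (i h₂.1) (i h₃.1) (i k₁.1) (i k₂.1) (i k₃.1)
    rcases this with h | h | h | h | h
    · exact Or.inl (hxext h₁.2 h₂.1 h)
    · exact Or.inr (Or.inl (hxext h₁.1 h₃.2 h))
    · exact Or.inr (Or.inr (Or.inl (hxext k₃.1 h₂.1 h)))
    · exact Or.inr (Or.inr (Or.inr (Or.inl (hxext k₁.1 h₃.1 h))))
    · exact Or.inr (Or.inr (Or.inr (Or.inr (hxext k₂.1 h₁.1 h))))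
  · rw [Fintype.card_subtype]
    refine (card_filter_prod_add_pow_le hq _).trans ?_
    rw [hK, ← pow_succ]
  · have h1 : Fintype.card L + (Finset.univ.filter fun z : K × K ↦ z.2 + z.2 ^ q = - z.1 ^ (q + 1)).card
        = q ^ 4 := by
      rw [Fintype.card_subtype, add_comm, Finset.card_filter_add_card_filter_not,
        Finset.card_univ, Fintype.card_prod, hK]; ring
    have h2 := card_filter_prod_add_pow_le hq (fun x : K ↦ - x ^ (q + 1))
    rw [hK, ← pow_succ] at h2
    simp only [Nat.reduceAdd] at h2
    omega
  · refine (Fintype.card_subtype_le _).trans ?_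
    rw [Fintype.card_prod, hK, ← pow_add]

/-! ### Weights of sets of lines -/

section Weights

variable {P L : Type} [DecidableEq P] (inc : L → Finset P)

/-- The factor by which the weight of a line drops once the points of `U` are occupied. -/
noncomputable def lineWeight (U : Finset P) (l : L) : ℝ := (1 / 2) ^ (inc l ∩ U).card

/-- With a random two-colouring of the lines through each point, independently for all points, the
probability that at each point `p` the lines of `X` through `p` have the same colour, which is
prescribed for the points of `U`. -/
noncomputable def setWeight [Fintype P] (U : Finset P) (X : Finset L) : ℝ :=
  -- At a free point one line may choose the colour; truncated subtraction gives factor 1 when no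
  -- line of `X` passes through `p`.
  ∏ p : P, (1 / 2) ^ ((X.filter (p ∈ inc ·)).card - if p ∈ U then 0 else 1)

/-- The total weight of the lines of `A`. -/
noncomputable def mass (U : Finset P) (A : Finset L) : ℝ := ∑ l ∈ A, lineWeight inc U l

/-- The generating function of the set weights. -/
noncomputable def weightGen [Fintype P] (z : ℝ) (U : Finset P) (A : Finset L) : ℝ :=
  ∑ S ∈ A.powerset, z ^ S.card * setWeight inc U S

variable {inc}

theorem lineWeight_pos (U : Finset P) (l : L) : 0 < lineWeight inc U l := by
  unfold lineWeight; positivity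

theorem lineWeight_le_one (U : Finset P) (l : L) : lineWeight inc U l ≤ 1 :=
  pow_le_one₀ (by norm_num) (by norm_num)

theorem lineWeight_anti {U U' : Finset P} (h : U ⊆ U') (l : L) :
    lineWeight inc U' l ≤ lineWeight inc U l :=
  pow_le_pow_of_le_one (by norm_num) (by norm_num)
    (Finset.card_le_card (Finset.inter_subset_inter_left h))

theorem lineWeight_union_le {U V : Finset P} {l : L} (h : ((inc l ∩ V) \ U).Nonempty) :
    lineWeight inc (U ∪ V) l ≤ lineWeight inc U l / 2 := by
  have h1 : (inc l ∩ U).card + 1 ≤ (inc l ∩ (U ∪ V)).card := by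
    obtain ⟨p, hp⟩ := h
    simp only [Finset.mem_sdiff, Finset.mem_inter] at hp
    rw [← Finset.card_insert_of_notMem (a := p) (by simp [hp.2])]
    refine Finset.card_le_card ?_
    rw [Finset.insert_subset_iff]
    exact ⟨by simp [hp.1], Finset.inter_subset_inter_left Finset.subset_union_left⟩
  calc lineWeight inc (U ∪ V) l ≤ (1 / 2) ^ ((inc l ∩ U).card + 1) :=
        pow_le_pow_of_le_one (by norm_num) (by norm_num) h1
    _ = _ := by unfold lineWeight; rw [pow_succ]; ring

theorem mass_mono {U U' : Finset P} {A A' : Finset L} (hU : U' ⊆ U) (hA : A ⊆ A') :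
    mass inc U A ≤ mass inc U' A' :=
  (Finset.sum_le_sum fun l _ ↦ lineWeight_anti hU l).trans
    (Finset.sum_le_sum_of_subset_of_nonneg hA fun l _ _ ↦ (lineWeight_pos U' l).le)

theorem setWeight_nonneg [Fintype P] (U : Finset P) (X : Finset L) : 0 ≤ setWeight inc U X :=
  Finset.prod_nonneg fun p _ ↦ by positivity

/-- Chain rule: `l` must match the prescribed colours on `U`, and afterwards it prescribes the
colours at its own points. -/
theorem setWeight_insert [DecidableEq L] [Fintype P] (U : Finset P) {l : L} {X : Finset L} (hl : l ∉ X) :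
    setWeight inc U (insert l X) = lineWeight inc U l * setWeight inc (U ∪ inc l) X := by
  have h : lineWeight inc U l = ∏ p : P, if p ∈ inc l ∩ U then (1 / 2 : ℝ) else 1 := by
    rw [Finset.prod_ite_mem, Finset.univ_inter, Finset.prod_const]; rfl
  rw [h, setWeight, setWeight, ← Finset.prod_mul_distrib]
  refine Finset.prod_congr rfl fun p _ ↦ ?_
  rw [Finset.filter_insert]
  by_cases hp : p ∈ inc l
  · rw [if_pos hp, Finset.card_insert_of_notMem (by simp [hl])]
    by_cases hU : p ∈ U
    · simp [hp, hU, pow_succ']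
    · simp [hp, hU]
  · simp [hp]

theorem weightGen_nonneg [Fintype P] {z : ℝ} (hz : 0 ≤ z) (U : Finset P) (A : Finset L) :
    0 ≤ weightGen inc z U A :=
  Finset.sum_nonneg fun S _ ↦ mul_nonneg (pow_nonneg hz _) (setWeight_nonneg U S)

theorem weightGen_insert [DecidableEq L] [Fintype P] (z : ℝ) (U : Finset P) {l : L} {A : Finset L} (hl : l ∉ A) :
    weightGen inc z U (insert l A)
      = weightGen inc z U A + z * lineWeight inc U l * weightGen inc z (U ∪ inc l) A := by
  rw [weightGen, Finset.sum_powerset_insert hl, weightGen, weightGen, Finset.mul_sum]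
  congr 1
  refine Finset.sum_congr rfl fun S hS ↦ ?_
  have hS' : l ∉ S := fun h ↦ hl (Finset.mem_powerset.1 hS h)
  rw [setWeight_insert U hS', Finset.card_insert_of_notMem hS']
  ring

/-- Occupying further points only lowers weights, so the sum is dominated by the product of the
factors `1 + z * lineWeight`. -/
theorem weightGen_le_exp_mass [DecidableEq L] [Fintype P] {z : ℝ} (hz : 0 ≤ z) (U : Finset P) (A : Finset L) :
    weightGen inc z U A ≤ Real.exp (z * mass inc U A) := by
  induction A using Finset.induction_on generalizing U with
  | empty => simp [weightGen, mass, setWeight]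
  | insert l A hl ih =>
    rw [weightGen_insert z U hl]
    have hw := (lineWeight_pos (inc := inc) U l).le
    have h1 : weightGen inc z (U ∪ inc l) A ≤ Real.exp (z * mass inc U A) :=
      (ih _).trans (Real.exp_le_exp.2 (mul_le_mul_of_nonneg_left
        (mass_mono Finset.subset_union_left subset_rfl) hz))
    calc _ ≤ Real.exp (z * mass inc U A)
          + z * lineWeight inc U l * Real.exp (z * mass inc U A) :=
          add_le_add (ih U) (mul_le_mul_of_nonneg_left h1 (mul_nonneg hz hw))
      _ = (z * lineWeight inc U l + 1) * Real.exp (z * mass inc U A) := by ring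
      _ ≤ Real.exp (z * lineWeight inc U l) * Real.exp (z * mass inc U A) :=
          mul_le_mul_of_nonneg_right (Real.add_one_le_exp _) (Real.exp_nonneg _)
      _ = _ := by rw [← Real.exp_add, mass, mass, Finset.sum_insert hl, mul_add]

/-- As long as the mass of `A` is large, choosing a suitable line reduces it substantially. -/
theorem exists_mass_union_le [DecidableEq L] [Fintype P] [Fintype L] {q : ℕ} (hq : 2 ≤ q) (hinc : IsONanFree inc q)
    (hP : Fintype.card P ≤ q ^ 3) (hL : (Fintype.card L : ℝ) * (1 / 2) ^ ((q + 1) / 2) ≤ 1)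
    (U : Finset P) (A : Finset L) (hM : 64 * (q : ℝ) ^ 2 ≤ mass inc U A) :
    ∃ l ∈ A, mass inc (U ∪ inc l) A ≤ mass inc U A * (1 - 1 / (64 * q)) := by
  set M := mass inc U A with hMdef
  set w := lineWeight inc U with hw
  have hq' : (2 : ℝ) ≤ q := by exact_mod_cast hq
  have hw0 : ∀ l, 0 < w l := fun l ↦ lineWeight_pos U l
  have hw1 : ∀ l, w l ≤ 1 := fun l ↦ lineWeight_le_one U l
  have hM4 : 4 ≤ M := le_trans (by nlinarith) hM
  let D : L → ℝ := fun v ↦ ∑ u ∈ A, if ((inc u ∩ inc v) \ U).Nonempty then w u else 0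
  -- the occupied points contribute little
  have hocc : ∑ l ∈ A, w l * ((inc l ∩ U).card : ℝ) ≤ ((q : ℝ) + 1) * (3 / 4 * M) := by
    have hterm : ∀ l ∈ A, w l * ((inc l ∩ U).card : ℝ)
        ≤ ((q : ℝ) + 1) / 2 * w l + ((q : ℝ) + 1) * (1 / 2) ^ ((q + 1) / 2) := by
      intro l _
      have hc : (inc l ∩ U).card ≤ q + 1 :=
        (Finset.card_le_card Finset.inter_subset_left).trans (hinc.card_inc l).le
      have hc' : ((inc l ∩ U).card : ℝ) ≤ q + 1 := by exact_mod_cast hc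
      -- A line with more than half of its points occupied has tiny weight; by `hL` all such lines
      -- together have weight at most 1, which `M ≥ 4` absorbs.
      by_cases h : 2 * (inc l ∩ U).card ≤ q + 1
      · have h' : 2 * ((inc l ∩ U).card : ℝ) ≤ q + 1 := by exact_mod_cast h
        have : 0 ≤ ((q : ℝ) + 1) * (1 / 2) ^ ((q + 1) / 2) := by positivity
        nlinarith [hw0 l]
      · have h1 : w l ≤ (1 / 2) ^ ((q + 1) / 2) :=
          pow_le_pow_of_le_one (by norm_num) (by norm_num) (by omega)
        have : 0 ≤ ((q : ℝ) + 1) / 2 * w l := mul_nonneg (by positivity) (hw0 l).le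
        calc _ ≤ (1 / 2) ^ ((q + 1) / 2) * ((q : ℝ) + 1) :=
              mul_le_mul h1 hc' (by positivity) (by positivity)
          _ ≤ _ := by linarith
    refine (Finset.sum_le_sum hterm).trans ?_
    rw [Finset.sum_add_distrib, ← Finset.mul_sum, Finset.sum_const, nsmul_eq_mul]
    have hA : (A.card : ℝ) * (1 / 2) ^ ((q + 1) / 2) ≤ 1 :=
      (mul_le_mul_of_nonneg_right (by exact_mod_cast Finset.card_le_univ A) (by positivity)).trans hL
    have : ∑ l ∈ A, w l = M := rfl
    rw [this]
    nlinarith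
  -- the weights of the free points
  let W : P → ℝ := fun p ↦ ∑ l ∈ A, if p ∈ inc l then w l else 0
  have hsumW : ∑ p ∈ Uᶜ, W p = ∑ l ∈ A, w l * ((inc l \ U).card : ℝ) := by
    rw [Finset.sum_comm]
    refine Finset.sum_congr rfl fun l _ ↦ ?_
    rw [← Finset.sum_filter, Finset.sum_const, nsmul_eq_mul, mul_comm]
    congr 3
    ext p; simp [and_comm]
  have hWlow : ((q : ℝ) + 1) * (M / 4) ≤ ∑ p ∈ Uᶜ, W p := by
    have : ∑ l ∈ A, w l * ((inc l \ U).card : ℝ) + ∑ l ∈ A, w l * ((inc l ∩ U).card : ℝ)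
        = ((q : ℝ) + 1) * M := by
      rw [← Finset.sum_add_distrib, hMdef, mass, Finset.mul_sum]
      refine Finset.sum_congr rfl fun l _ ↦ ?_
      rw [← mul_add, ← Nat.cast_add, Finset.card_sdiff_add_card_inter, hinc.card_inc]
      push_cast; ring
    rw [hsumW]; linarith
  have hCS : (((q : ℝ) + 1) * (M / 4)) ^ 2 ≤ (q : ℝ) ^ 3 * ∑ p ∈ Uᶜ, W p ^ 2 := by
    calc _ ≤ (∑ p ∈ Uᶜ, W p) ^ 2 := pow_le_pow_left₀ (by positivity) hWlow 2
      _ ≤ ((Uᶜ).card : ℝ) * ∑ p ∈ Uᶜ, W p ^ 2 := sq_sum_le_card_mul_sum_sq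
      _ ≤ _ := mul_le_mul_of_nonneg_right
          (by exact_mod_cast (Finset.card_le_univ _).trans hP)
          (Finset.sum_nonneg fun _ _ ↦ sq_nonneg _)
  -- The sum of squares counts weighted pairs of lines meeting at a free point: distinct lines meet
  -- at most once, and the diagonal contributes the `q + 1`.
  have hsq : ∑ p ∈ Uᶜ, W p ^ 2 ≤ ∑ v ∈ A, w v * (D v + (q + 1)) := by
    have h1 : ∑ p ∈ Uᶜ, W p ^ 2
        = ∑ v ∈ A, w v * ∑ u ∈ A, w u * (((inc u ∩ inc v) \ U).card : ℝ) := by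
      calc _ = ∑ p ∈ Uᶜ, ∑ v ∈ A, ∑ u ∈ A,
              if p ∈ inc u ∩ inc v then w v * w u else 0 := by
            refine Finset.sum_congr rfl fun p _ ↦ ?_
            rw [sq, Finset.sum_mul_sum]
            refine Finset.sum_congr rfl fun v _ ↦ Finset.sum_congr rfl fun u _ ↦ ?_
            by_cases h1 : p ∈ inc v <;> by_cases h2 : p ∈ inc u <;> simp [h1, h2]
        _ = _ := by
            rw [Finset.sum_comm]
            refine Finset.sum_congr rfl fun v _ ↦ ?_
            rw [Finset.sum_comm, Finset.mul_sum]
            refine Finset.sum_congr rfl fun u _ ↦ ?_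
            have h2 : Uᶜ.filter (· ∈ inc u ∩ inc v) = (inc u ∩ inc v) \ U := by
              ext p
              rw [Finset.mem_filter, Finset.mem_compl, Finset.mem_sdiff, and_comm]
            rw [← Finset.sum_filter, Finset.sum_const, nsmul_eq_mul, h2]
            ring
    rw [h1]
    refine Finset.sum_le_sum fun v hv ↦ mul_le_mul_of_nonneg_left ?_ (hw0 v).le
    have h2 : D v + ((q : ℝ) + 1) = ∑ u ∈ A, ((if ((inc u ∩ inc v) \ U).Nonempty then w u else 0)
        + if u = v then (q : ℝ) + 1 else 0) := by
      rw [Finset.sum_add_distrib, Finset.sum_ite_eq', if_pos hv]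
    rw [h2]
    refine Finset.sum_le_sum fun u _ ↦ ?_
    by_cases huv : u = v
    · rw [if_pos huv]
      have hc : (((inc u ∩ inc v) \ U).card : ℝ) ≤ q + 1 := by
        have := (Finset.card_le_card
          (Finset.sdiff_subset.trans Finset.inter_subset_left :
            (inc u ∩ inc v) \ U ⊆ inc u)).trans (hinc.card_inc u).le
        exact_mod_cast this
      have h3 : w u * (((inc u ∩ inc v) \ U).card : ℝ) ≤ 1 * (q + 1) :=
        mul_le_mul (hw1 u) hc (by positivity) zero_le_one
      have h4 : (0 : ℝ) ≤ if ((inc u ∩ inc v) \ U).Nonempty then w u else 0 := by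
        split_ifs; exacts [(hw0 u).le, le_rfl]
      linarith
    · rw [if_neg huv, add_zero]
      by_cases hne : ((inc u ∩ inc v) \ U).Nonempty
      · rw [if_pos hne]
        have hc : (((inc u ∩ inc v) \ U).card : ℝ) ≤ 1 := by
          exact_mod_cast (Finset.card_le_card Finset.sdiff_subset).trans
            (hinc.card_inter_le u v huv)
        exact mul_le_of_le_one_right (hw0 u).le hc
      · rw [if_neg hne, Finset.not_nonempty_iff_eq_empty.1 hne]; simp
  have hD : ∃ v ∈ A, M / (32 * q) ≤ D v := by
    by_contra! hcon
    have h1 : ∑ v ∈ A, w v * (D v + (q + 1)) ≤ M * (M / (32 * q) + (q + 1)) := by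
      have h0 : M * (M / (32 * q) + (q + 1)) = ∑ v ∈ A, w v * (M / (32 * q) + (q + 1)) :=
        Finset.sum_mul _ _ _
      rw [h0]
      exact Finset.sum_le_sum fun v hv ↦
        mul_le_mul_of_nonneg_left (by linarith [hcon v hv]) (hw0 v).le
    have h2 : (((q : ℝ) + 1) * (M / 4)) ^ 2 ≤ (q : ℝ) ^ 3 * (M * (M / (32 * q) + (q + 1))) :=
      hCS.trans (mul_le_mul_of_nonneg_left (hsq.trans h1) (by positivity))
    have h3 : (q : ℝ) ^ 3 * (M * (M / (32 * q) + (q + 1)))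
        = M * (q ^ 2 * M / 32 + q ^ 3 * (q + 1)) := by
      field_simp
    have h4 : (((q : ℝ) + 1) * (M / 4)) ^ 2 = M * ((q + 1) ^ 2 * M / 16) := by ring
    rw [h3, h4] at h2
    have h5 := le_of_mul_le_mul_left h2 (by linarith)
    have h6 : (q : ℝ) ^ 2 * (M / 32) ≤ q ^ 2 * (q * (q + 1)) := by nlinarith
    have h7 := le_of_mul_le_mul_left h6 (by positivity)
    nlinarith
  obtain ⟨v, hv, hDv⟩ := hD
  refine ⟨v, hv, ?_⟩
  -- Every line meeting `v` at a free point loses at least half of its weight.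
  have h1 : mass inc (U ∪ inc v) A ≤ M - D v / 2 := by
    rw [hMdef, mass, mass, Finset.sum_div, ← Finset.sum_sub_distrib]
    refine Finset.sum_le_sum fun u _ ↦ ?_
    split_ifs with h
    · linarith [lineWeight_union_le h]
    · linarith [lineWeight_anti (inc := inc) (U := U) (U' := U ∪ inc v) Finset.subset_union_left u]
  have h2 : M * (1 - 1 / (64 * q)) = M - M / (32 * q) / 2 := by field_simp; ring
  rw [h2]; linarith

/-- `R` bounds how often the mass can still drop before it reaches `64 q^2`. Branch on the line `l`
of `exists_mass_union_le`: sets avoiding `l` keep `R`, sets containing it use up one drop. Below the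
threshold `weightGen_le_exp_mass` takes over. -/
theorem weightGen_le [DecidableEq L] [Fintype P] [Fintype L] {q : ℕ} (hq : 2 ≤ q) (hinc : IsONanFree inc q)
    (hP : Fintype.card P ≤ q ^ 3) (hL : (Fintype.card L : ℝ) * (1 / 2) ^ ((q + 1) / 2) ≤ 1)
    {z : ℝ} (hz : 0 ≤ z) (hz1 : z ≤ 1) (N R : ℕ) (U : Finset P) (A : Finset L) (hN : A.card = N)
    (hM : mass inc U A * (1 - 1 / (64 * q)) ^ R ≤ 64 * (q : ℝ) ^ 2) :
    weightGen inc z U A ≤ Real.exp (z * (64 * (q : ℝ) ^ 2)) * ((N : ℝ) + 1) ^ R := by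
  have hq' : (2 : ℝ) ≤ q := by exact_mod_cast hq
  have hρ0 : 0 ≤ 1 - 1 / (64 * (q : ℝ)) := by
    rw [sub_nonneg, div_le_one (by positivity)]; linarith
  induction N generalizing R U A with
  | zero =>
    rw [Finset.card_eq_zero] at hN
    subst hN
    have : weightGen inc z U (∅ : Finset L) = 1 := by simp [weightGen, setWeight]
    rw [this]; simp; positivity
  | succ N ih =>
    by_cases hle : mass inc U A ≤ 64 * (q : ℝ) ^ 2
    · refine (weightGen_le_exp_mass hz U A).trans ?_
      calc _ ≤ Real.exp (z * (64 * (q : ℝ) ^ 2)) * 1 := by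
            rw [mul_one]; exact Real.exp_le_exp.2 (mul_le_mul_of_nonneg_left hle hz)
        _ ≤ _ := mul_le_mul_of_nonneg_left (one_le_pow₀ (by linarith [Nat.cast_nonneg (α := ℝ) (N + 1)]))
            (Real.exp_nonneg _)
    · push Not at hle
      obtain ⟨R, rfl⟩ : ∃ R', R = R' + 1 := by
        refine ⟨R - 1, ?_⟩
        rcases R with - | R
        · rw [pow_zero, mul_one] at hM; linarith
        · rfl
      obtain ⟨l, hl, hlM⟩ := exists_mass_union_le hq hinc hP hL U A hle.le
      have hcard : (A.erase l).card = N := by rw [Finset.card_erase_of_mem hl, hN]; rfl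
      have h1 := ih (R + 1) U (A.erase l) hcard
        ((mul_le_mul_of_nonneg_right (mass_mono subset_rfl (Finset.erase_subset _ _))
          (pow_nonneg hρ0 _)).trans hM)
      have h2 := ih R (U ∪ inc l) (A.erase l) hcard (by
        refine le_trans ?_ hM
        rw [pow_succ', ← mul_assoc]
        exact mul_le_mul_of_nonneg_right
          ((mass_mono subset_rfl (Finset.erase_subset _ _)).trans hlM) (pow_nonneg hρ0 _))
      have h0 := weightGen_nonneg (inc := inc) hz (U ∪ inc l) (A.erase l)
      have hzw : z * lineWeight inc U l ≤ 1 :=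
        mul_le_one₀ hz1 (lineWeight_pos U l).le (lineWeight_le_one U l)
      rw [← Finset.insert_erase hl, weightGen_insert z U (Finset.notMem_erase l A)]
      set E := Real.exp (z * (64 * (q : ℝ) ^ 2))
      have hE : 0 ≤ E := Real.exp_nonneg _
      have hNn : (0 : ℝ) ≤ N := Nat.cast_nonneg N
      calc _ ≤ E * ((N : ℝ) + 1) ^ (R + 1) + 1 * (E * ((N : ℝ) + 1) ^ R) :=
            add_le_add h1 ((mul_le_mul_of_nonneg_right hzw h0).trans
              (mul_le_mul_of_nonneg_left h2 zero_le_one))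
        _ = E * (((N : ℝ) + 1) ^ R * (N + 1 + 1)) := by ring
        _ ≤ E * (((N : ℝ) + 1 + 1) ^ R * (N + 1 + 1)) := by
            gcongr; linarith
        _ = _ := by push_cast; ring

/-- The sum of the weights of the images of all `t`-tuples of lines. -/
theorem sum_setWeight_image_le [DecidableEq L] [Fintype P] [Fintype L] {q : ℕ} (hq : 2 ≤ q)
    (hinc : IsONanFree inc q) (hP : Fintype.card P ≤ q ^ 3)
    (hL : (Fintype.card L : ℝ) * (1 / 2) ^ ((q + 1) / 2) ≤ 1)
    {ι : Type*} [Fintype ι] [DecidableEq ι] {t : ℕ} (hι : Fintype.card ι = t) (ht0 : 0 < t)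
    (ht : (t : ℝ) ≤ 64 * (q : ℝ) ^ 2) {R : ℕ}
    (hR : (Fintype.card L : ℝ) * (1 - 1 / (64 * q)) ^ R ≤ 64 * (q : ℝ) ^ 2) :
    ∑ f : ι → L, setWeight inc ∅ (Finset.univ.image f)
      ≤ (64 * (q : ℝ) ^ 2) ^ t * (Real.exp t * ((Fintype.card L : ℝ) + 1) ^ R) := by
  set m := 64 * (q : ℝ) ^ 2 with hm
  have hq' : (2 : ℝ) ≤ q := by exact_mod_cast hq
  have hm0 : 0 < m := by positivity
  have ht0' : (0 : ℝ) < t := by exact_mod_cast ht0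
  -- The choice `z = t / m` turns `exp (z * m)` into `exp t`, while the at most `t ^ t` maps onto a
  -- set `S` with `S.card ≤ t` number at most `m ^ t * z ^ S.card`.
  have hz0 : 0 < (t : ℝ) / m := by positivity
  have hz1 : (t : ℝ) / m ≤ 1 := (div_le_one hm0).2 ht
  have hgen := weightGen_le hq hinc hP hL hz0.le hz1 (Fintype.card L) R ∅ Finset.univ
    Finset.card_univ (by simpa [mass, lineWeight] using hR)
  rw [← hm, div_mul_cancel₀ _ hm0.ne'] at hgen
  refine le_trans ?_ (mul_le_mul_of_nonneg_left hgen (by positivity))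
  rw [weightGen, Finset.powerset_univ, Finset.mul_sum,
    ← Finset.sum_fiberwise_of_maps_to (s := Finset.univ) (t := Finset.univ)
      (g := fun f : ι → L ↦ Finset.univ.image f) (fun _ _ ↦ Finset.mem_univ _)]
  refine Finset.sum_le_sum fun S _ ↦ ?_
  have h1 : ∑ f : ι → L with Finset.univ.image f = S, setWeight inc ∅ (Finset.univ.image f)
      = ((Finset.univ.filter fun f : ι → L ↦ Finset.univ.image f = S).card : ℝ)
        * setWeight inc ∅ S := by
    rw [← nsmul_eq_mul, ← Finset.sum_const]
    refine Finset.sum_congr rfl fun f hf ↦ ?_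
    rw [(Finset.mem_filter.1 hf).2]
  rw [h1, ← mul_assoc]
  refine mul_le_mul_of_nonneg_right ?_ (setWeight_nonneg _ _)
  by_cases hSt : S.card ≤ t
  · have h2 : (Finset.univ.filter fun f : ι → L ↦ Finset.univ.image f = S).card ≤ t ^ t := by
      calc _ ≤ (Fintype.piFinset fun _ : ι ↦ S).card := by
            refine Finset.card_le_card fun f hf ↦ ?_
            rw [Fintype.mem_piFinset]
            intro i
            rw [← (Finset.mem_filter.1 hf).2]
            exact Finset.mem_image_of_mem f (Finset.mem_univ i)
        _ = S.card ^ t := by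
            rw [Fintype.card_piFinset, Finset.prod_const, Finset.card_univ, hι]
        _ ≤ _ := Nat.pow_le_pow_left hSt t
    calc _ ≤ ((t ^ t : ℕ) : ℝ) := by exact_mod_cast h2
      _ = m ^ t * ((t : ℝ) / m) ^ t := by
          rw [← mul_pow, mul_div_cancel₀ _ hm0.ne']; push_cast; ring
      _ ≤ _ := mul_le_mul_of_nonneg_left (pow_le_pow_of_le_one hz0.le hz1 hSt) (by positivity)
  · rw [Finset.filter_false_of_mem, Finset.card_empty, Nat.cast_zero]
    · positivity
    · rintro f - rfl
      exact hSt (Finset.card_image_le.trans_eq (by rw [Finset.card_univ, hι]))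

end Weights

/-! ### Random homomorphisms and colourings -/

/-- The number of two-colourings of a finite set that are constant on a given subset. -/
theorem card_filter_constant_on_le {L : Type*} [Fintype L] [DecidableEq L] (Y : Finset L) :
    ((Finset.univ.filter fun τ : L → Bool ↦ ∀ l ∈ Y, ∀ m ∈ Y, τ l = τ m).card : ℝ)
      ≤ 2 ^ Fintype.card L * (1 / 2) ^ (Y.card - 1) := by
  rcases Y.eq_empty_or_nonempty with rfl | ⟨y, hy⟩
  · simp
  · have h1 : (Finset.univ.filter fun τ : L → Bool ↦ ∀ l ∈ Y, ∀ m ∈ Y, τ l = τ m).card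
        ≤ Fintype.card (Bool × ({l // l ∉ Y} → Bool)) := by
      rw [← Finset.card_univ]
      refine Finset.card_le_card_of_injOn (fun τ ↦ (τ y, fun l ↦ τ l.1)) (fun _ _ ↦ by simp) ?_
      intro τ hτ τ' hτ' h
      simp only [Finset.coe_filter, Finset.mem_univ, true_and, Set.mem_ofPred_eq] at hτ hτ'
      simp only [Prod.mk.injEq] at h
      funext l
      by_cases hl : l ∈ Y
      · rw [hτ l hl y hy, hτ' l hl y hy, h.1]
      · exact congrFun h.2 ⟨l, hl⟩
    have h2 : Fintype.card (Bool × ({l // l ∉ Y} → Bool)) = 2 ^ (1 + (Fintype.card L - Y.card)) := by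
      rw [Fintype.card_prod, Fintype.card_bool, Fintype.card_fun, Fintype.card_bool, pow_add, pow_one,
        Fintype.card_subtype_compl, Fintype.card_coe]
    rw [h2] at h1
    have hpos : 0 < Y.card := Finset.card_pos.2 ⟨y, hy⟩
    have hle : Y.card ≤ Fintype.card L := Finset.card_le_univ Y
    calc _ ≤ ((2 ^ (1 + (Fintype.card L - Y.card)) : ℕ) : ℝ) := by exact_mod_cast h1
      _ = _ := by
          obtain ⟨a, ha⟩ : ∃ a, Y.card = a + 1 := ⟨Y.card - 1, by omega⟩
          obtain ⟨b, hb⟩ : ∃ b, Fintype.card L = a + 1 + b := ⟨Fintype.card L - (a + 1), by omega⟩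
          rw [ha, hb]
          simp only [Nat.add_sub_cancel_left, Nat.add_sub_cancel]
          push_cast
          rw [show a + 1 + b = 1 + b + a by ring, pow_add 2 (1 + b) a, mul_assoc, ← mul_pow]
          norm_num

section Colouring

variable {P L : Type} [Fintype P] [Fintype L] [DecidableEq P] [DecidableEq L] {inc : L → Finset P}

/-- The colourings at different points are independent, so the count is a product over the points.
-/
theorem card_filter_colourings_le (X : Finset L) :
    ((Finset.univ.filter fun σ : P → L → Bool ↦ ∀ p, ∀ l ∈ X, ∀ m ∈ X, p ∈ inc l → p ∈ inc m →
      σ p l = σ p m).card : ℝ)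
      ≤ Fintype.card (P → L → Bool) * setWeight inc ∅ X := by
  have h1 : (Finset.univ.filter fun σ : P → L → Bool ↦ ∀ p, ∀ l ∈ X, ∀ m ∈ X, p ∈ inc l →
      p ∈ inc m → σ p l = σ p m) = Fintype.piFinset fun p ↦ Finset.univ.filter
        fun τ : L → Bool ↦ ∀ l ∈ X.filter (p ∈ inc ·), ∀ m ∈ X.filter (p ∈ inc ·), τ l = τ m := by
    ext σ
    simp only [Finset.mem_filter, Finset.mem_univ, true_and, Fintype.mem_piFinset]
    constructor
    · intro h p l hl m hm; exact h p l hl.1 m hm.1 hl.2 hm.2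
    · intro h p l hl m hm hpl hpm; exact h p l ⟨hl, hpl⟩ m ⟨hm, hpm⟩
  rw [h1, Fintype.card_piFinset, Nat.cast_prod]
  calc _ ≤ ∏ p : P, ((2 : ℝ) ^ Fintype.card L * (1 / 2) ^ ((X.filter (p ∈ inc ·)).card - 1)) :=
        Finset.prod_le_prod (fun _ _ ↦ Nat.cast_nonneg _) fun p _ ↦ card_filter_constant_on_le _
    _ = _ := by
        rw [Finset.prod_mul_distrib, setWeight]
        simp

/-- The average over all maps only depends on the values on `T`. -/
theorem sum_image_eq {V : Type*} [Fintype V] [DecidableEq V] (T : Finset V) (F : Finset L → ℝ) :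
    ∑ φ : V → L, F (T.image φ)
      = (Fintype.card L : ℝ) ^ (Fintype.card V - T.card)
        * ∑ f : {x // x ∈ T} → L, F (Finset.univ.image f) := by
  rw [← (Equiv.piEquivPiSubtypeProd (· ∈ T) fun _ ↦ L).symm.sum_comp, Fintype.sum_prod_type,
    Finset.mul_sum]
  refine Finset.sum_congr rfl fun f _ ↦ ?_
  have h : ∀ g : {x // x ∉ T} → L,
      T.image ((Equiv.piEquivPiSubtypeProd (· ∈ T) fun _ ↦ L).symm (f, g))
        = Finset.univ.image f := by
    intro g
    ext l
    simp only [Finset.mem_image, Finset.mem_univ, true_and, Subtype.exists,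
      Equiv.piEquivPiSubtypeProd_symm_apply]
    constructor
    · rintro ⟨x, hx, h⟩; rw [dif_pos hx] at h; exact ⟨x, hx, h⟩
    · rintro ⟨x, hx, h⟩; refine ⟨x, hx, ?_⟩; rw [dif_pos hx]; exact h
  simp only [h, Finset.sum_const, Finset.card_univ, nsmul_eq_mul]
  rw [Fintype.card_fun, Fintype.card_subtype_compl, Fintype.card_coe]
  push_cast; rfl

/-- If the expected number of blue `t`-cliques is less than one, some colouring has no red `K₄` and
no blue `K_t`. -/
theorem not_isRamseyGraph_of_card_lt {q : ℕ} (hinc : IsONanFree inc q)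
    {V : Type*} [Fintype V] [DecidableEq V] (G : SimpleGraph V) [DecidableRel G.Adj] {t : ℕ}
    (hL : 0 < Fintype.card L) {B : ℝ}
    (hB : ∀ T : Finset V, T.card = t →
      ∑ f : {x // x ∈ T} → L, setWeight inc ∅ (Finset.univ.image f) ≤ B)
    (hcard : ((G.cliqueFinset t).card : ℝ) * B < (Fintype.card L : ℝ) ^ t) :
    ¬ IsRamseyGraph G 4 t := by
  have hL' : (0 : ℝ) < Fintype.card L := by exact_mod_cast hL
  -- choose the map
  obtain ⟨φ, hφ⟩ : ∃ φ : V → L, ∑ T ∈ G.cliqueFinset t, setWeight inc ∅ (T.image φ) < 1 := by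
    by_contra! hcon
    have h1 : (Fintype.card L : ℝ) ^ Fintype.card V
        ≤ ∑ φ : V → L, ∑ T ∈ G.cliqueFinset t, setWeight inc ∅ (T.image φ) := by
      calc _ = ∑ _φ : V → L, (1 : ℝ) := by simp
        _ ≤ _ := Finset.sum_le_sum fun φ _ ↦ hcon φ
    rw [Finset.sum_comm] at h1
    have h2 : ∀ T ∈ G.cliqueFinset t, ∑ φ : V → L, setWeight inc ∅ (T.image φ)
        ≤ (Fintype.card L : ℝ) ^ (Fintype.card V - t) * B := by
      intro T hT
      have hTt := (SimpleGraph.mem_cliqueFinset_iff.1 hT).card_eq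
      rw [sum_image_eq, hTt]
      exact mul_le_mul_of_nonneg_left (hB T hTt) (by positivity)
    have h3 := h1.trans (Finset.sum_le_sum h2)
    rw [Finset.sum_const, nsmul_eq_mul] at h3
    rcases (G.cliqueFinset t).eq_empty_or_nonempty with h0 | ⟨T, hT⟩
    · rw [h0] at h3
      simp only [Finset.card_empty, Nat.cast_zero, zero_mul] at h3
      exact absurd h3 (not_le.2 (by positivity))
    · have htV : t ≤ Fintype.card V := by
        rw [← (SimpleGraph.mem_cliqueFinset_iff.1 hT).card_eq]; exact Finset.card_le_univ T
      have h4 : (Fintype.card L : ℝ) ^ Fintype.card V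
          = (Fintype.card L : ℝ) ^ (Fintype.card V - t) * (Fintype.card L : ℝ) ^ t := by
        rw [← pow_add, Nat.sub_add_cancel htV]
      rw [h4, mul_left_comm] at h3
      exact absurd (le_of_mul_le_mul_left h3 (by positivity)) (not_le.2 hcard)
  -- choose the bits
  obtain ⟨σ, hσ⟩ : ∃ σ : P → L → Bool, ∀ T ∈ G.cliqueFinset t,
      ¬ ∀ p, ∀ l ∈ T.image φ, ∀ m ∈ T.image φ, p ∈ inc l → p ∈ inc m → σ p l = σ p m := by
    by_contra! hcon
    have h1 : (Finset.univ : Finset (P → L → Bool)) ⊆ (G.cliqueFinset t).biUnion fun T ↦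
        Finset.univ.filter fun σ : P → L → Bool ↦ ∀ p, ∀ l ∈ T.image φ, ∀ m ∈ T.image φ,
          p ∈ inc l → p ∈ inc m → σ p l = σ p m := by
      intro σ _
      obtain ⟨T, hT, h⟩ := hcon σ
      exact Finset.mem_biUnion.2 ⟨T, hT, Finset.mem_filter.2 ⟨Finset.mem_univ _, h⟩⟩
    have h2 := (Finset.card_le_card h1).trans Finset.card_biUnion_le
    have h3 : (Fintype.card (P → L → Bool) : ℝ) ≤ ∑ T ∈ G.cliqueFinset t,
        (Fintype.card (P → L → Bool) : ℝ) * setWeight inc ∅ (T.image φ) := by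
      refine le_trans ?_ (Finset.sum_le_sum fun T _ ↦ card_filter_colourings_le (T.image φ))
      rw [Finset.card_univ] at h2
      exact_mod_cast h2
    rw [← Finset.mul_sum] at h3
    have h4 : (0 : ℝ) < Fintype.card (P → L → Bool) := by exact_mod_cast Fintype.card_pos
    nlinarith
  -- the colouring
  let red : V → V → Prop := fun x y ↦
    ∃ p, p ∈ inc (φ x) ∧ p ∈ inc (φ y) ∧ σ p (φ x) ≠ σ p (φ y)
  have hsymm : ∀ x y, red x y → red y x := fun x y ⟨p, h1, h2, h3⟩ ↦ ⟨p, h2, h1, h3.symm⟩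
  classical
  let C : G.EdgeLabeling Bool := SimpleGraph.EdgeLabeling.mk (fun x y _ ↦ decide (red x y))
    fun x y _ ↦ by rw [decide_eq_decide]; exact ⟨hsymm y x, hsymm x y⟩
  have hC : ∀ k x y, (C.labelGraph k).Adj x y ↔ ∃ _ : G.Adj x y, decide (red x y) = k :=
    fun k x y ↦ SimpleGraph.EdgeLabeling.labelGraph_adj x y
  intro hR
  rcases hR C with h | h
  · obtain ⟨e⟩ := (SimpleGraph.not_cliqueFree_iff_top_isContained 4).1 h
    have hred : ∀ {x y}, (C.labelGraph true).Adj x y → red x y := fun h ↦ by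
      obtain ⟨_, h'⟩ := (hC _ _ _).1 h; exact of_decide_eq_true h'
    have hne : ∀ {x y}, red x y → φ x ≠ φ y := by
      rintro x y ⟨p, -, -, h⟩ e; rw [e] at h; exact h rfl
    have huniq : ∀ {x y p r}, red x y → p ∈ inc (φ x) → p ∈ inc (φ y) → r ∈ inc (φ x) →
        r ∈ inc (φ y) → p = r := fun h h1 h2 h3 h4 ↦
      Finset.card_le_one.1 (hinc.card_inter_le _ _ (hne h)) _ (Finset.mem_inter.2 ⟨h1, h2⟩) _
        (Finset.mem_inter.2 ⟨h3, h4⟩)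
    -- Three lines through one point cannot have pairwise different colours out of two.
    have htri : ∀ {x y z p}, red x y → red y z → red x z → p ∈ inc (φ x) → p ∈ inc (φ y) →
        p ∈ inc (φ z) → False := by
      intro x y z p hxy hyz hxz hx hy hz
      obtain ⟨p₁, h₁, h₁', e₁⟩ := id hxy
      obtain ⟨p₂, h₂, h₂', e₂⟩ := id hyz
      obtain ⟨p₃, h₃, h₃', e₃⟩ := id hxz
      obtain rfl := huniq hxy hx hy h₁ h₁'
      obtain rfl := huniq hyz hy hz h₂ h₂'
      obtain rfl := huniq hxz hx hz h₃ h₃'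
      revert e₁ e₂ e₃
      cases σ p (φ x) <;> cases σ p (φ y) <;> cases σ p (φ z) <;> simp
    have hadj : ∀ i j : Fin 4, i ≠ j → red (e i) (e j) := fun i j hij ↦ 
      hred (e.toHom.map_adj ((SimpleGraph.top_adj i j).2 hij))
    have hab := hadj 0 1 (by decide)
    have hac := hadj 0 2 (by decide)
    have had := hadj 0 3 (by decide)
    have hbc := hadj 1 2 (by decide)
    have hbd := hadj 1 3 (by decide)
    have hcd := hadj 2 3 (by decide)
    obtain ⟨p₁, hp₁, hp₁', -⟩ := id hbc
    obtain ⟨p₂, hp₂, hp₂', -⟩ := id hac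
    obtain ⟨p₃, hp₃, hp₃', -⟩ := id hab
    obtain ⟨q₁, hq₁, hq₁', -⟩ := id had
    obtain ⟨q₂, hq₂, hq₂', -⟩ := id hbd
    obtain ⟨q₃, hq₃, hq₃', -⟩ := id hcd
    rcases hinc.onan (φ (e 0)) (φ (e 1)) (φ (e 2)) (φ (e 3)) (hne hab) (hne hac) (hne had) (hne hbc) (hne hbd)
      (hne hcd) p₁ p₂ p₃ q₁ q₂ q₃ (Finset.mem_inter.2 ⟨hp₁, hp₁'⟩) (Finset.mem_inter.2 ⟨hp₂', hp₂⟩)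
      (Finset.mem_inter.2 ⟨hp₃, hp₃'⟩) (Finset.mem_inter.2 ⟨hq₁, hq₁'⟩)
      (Finset.mem_inter.2 ⟨hq₂, hq₂'⟩) (Finset.mem_inter.2 ⟨hq₃, hq₃'⟩) with h | h | h | h | h
    · subst h; exact htri hab hbc hac hp₂ hp₁ hp₁'
    · subst h; exact htri hab hbc hac hp₃ hp₁ hp₁'
    · subst h; exact htri hac hcd had hp₂ hq₃ hq₃'
    · subst h; exact htri hab hbd had hq₁ hp₃' hq₁'
    · subst h; exact htri hbc hcd hbd hq₂ hp₁' hq₂'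
  -- In a blue clique, lines of the image through a common point have equal colours there, which the
  -- choice of `σ` forbids.
  · refine h fun S hS ↦ ?_
    have hS' : S ∈ G.cliqueFinset t := SimpleGraph.mem_cliqueFinset_iff.2
      (hS.mono (SimpleGraph.EdgeLabeling.labelGraph_le C))
    refine hσ S hS' fun p l hl m hm hpl hpm ↦ ?_
    obtain ⟨x, hx, rfl⟩ := Finset.mem_image.1 hl
    obtain ⟨y, hy, rfl⟩ := Finset.mem_image.1 hm
    by_contra hne
    have hxy : x ≠ y := fun e ↦ hne (by rw [e])
    obtain ⟨_, h'⟩ := (hC _ _ _).1 (hS.isClique hx hy hxy)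
    exact of_decide_eq_false h' ⟨p, hpl, hpm, hne⟩

end Colouring

/-! ### Cliques -/

theorem copyCount_eq_of_forall {V W : Type*} [Fintype V] (G : SimpleGraph V) (F : SimpleGraph W)
    (n : ℕ) (h : ∀ (_ : Fintype G.Subgraph)
      (_ : DecidablePred fun H : G.Subgraph ↦ Nonempty (F ≃g H.coe)),
      n = (Finset.univ.filter fun H : G.Subgraph ↦ Nonempty (F ≃g H.coe)).card) :
    G.copyCount F = n := by
  rw [SimpleGraph.copyCount]
  symm
  exact h _ _

/-- A copy of a complete graph is the subgraph induced on its vertex set. -/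
theorem copyCount_completeGraph {V : Type*} [Fintype V] [DecidableEq V] (G : SimpleGraph V)
    [DecidableRel G.Adj] (s : ℕ) :
    G.copyCount (SimpleGraph.completeGraph (Fin s)) = (G.cliqueFinset s).card := by
  refine copyCount_eq_of_forall _ _ _ fun _ _ ↦ ?_
  classical
  refine Finset.card_bij (fun S _ ↦ (⊤ : G.Subgraph).induce (S : Set V)) ?_ ?_ ?_
  · intro S hS
    rw [SimpleGraph.mem_cliqueFinset_iff] at hS
    rw [Finset.mem_filter_univ]
    have f : Fin s ≃ ((⊤ : G.Subgraph).induce (S : Set V)).verts :=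
      Fintype.equivOfCardEq (by
        rw [Fintype.card_fin, ← hS.card_eq, SimpleGraph.Subgraph.induce_verts]; simp)
    refine ⟨⟨f, ?_⟩⟩
    intro i j
    have hinj := f.injective
    simp only [SimpleGraph.Subgraph.coe_adj, SimpleGraph.Subgraph.induce_adj, SimpleGraph.top_adj,
      SimpleGraph.Subgraph.top_adj]
    constructor
    · rintro ⟨_, _, h⟩ rfl; exact h.ne rfl
    · intro hij
      exact ⟨Subtype.coe_prop _, Subtype.coe_prop _, hS.isClique (Subtype.coe_prop _)
        (Subtype.coe_prop _) fun h ↦ hij (hinj (Subtype.ext h))⟩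
  · intro S _ T _ h
    exact Finset.coe_injective (congrArg SimpleGraph.Subgraph.verts h)
  · intro H hH
    rw [Finset.mem_filter_univ] at hH
    obtain ⟨e⟩ := hH
    have hadj : ∀ x ∈ H.verts, ∀ y ∈ H.verts, x ≠ y → H.Adj x y := by
      intro x hx y hy hxy
      have h : H.coe.Adj (e (e.symm ⟨x, hx⟩)) (e (e.symm ⟨y, hy⟩)) := by
        refine e.map_rel_iff.2 ((SimpleGraph.top_adj _ _).2 fun h ↦ hxy ?_)
        exact congrArg Subtype.val (e.symm.injective h)
      simpa using h
    refine ⟨H.verts.toFinset, ?_, ?_⟩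
    · rw [SimpleGraph.mem_cliqueFinset_iff, SimpleGraph.isNClique_iff]
      refine ⟨?_, ?_⟩
      · intro x hx y hy hxy
        rw [Set.coe_toFinset] at hx hy
        exact (hadj x hx y hy hxy).adj_sub
      · rw [Set.toFinset_card, ← Fintype.card_congr e.toEquiv, Fintype.card_fin]
    · ext x y
      · simp
      · simp only [Set.coe_toFinset, SimpleGraph.Subgraph.induce_adj, SimpleGraph.Subgraph.top_adj]
        exact ⟨fun ⟨hx, hy, h⟩ ↦ hadj x hx y hy h.ne,
          fun h ↦ ⟨H.edge_vert h, H.edge_vert h.symm, h.adj_sub⟩⟩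

open scoped FinsetFamily in
/-- The Kruskal–Katona theorem for cliques. -/
theorem choose_le_card_cliqueFinset {V : Type*} [Fintype V] [DecidableEq V] (G : SimpleGraph V)
    [DecidableRel G.Adj] {k s t : ℕ} (hst : s ≤ t) (ht : 0 < t) (htk : t ≤ k)
    (h : k.choose t ≤ (G.cliqueFinset t).card) : k.choose s ≤ (G.cliqueFinset s).card := by
  classical
  let e := Fintype.equivFin V
  have hcard : ∀ r, ((G.map e.toEmbedding).cliqueFinset r).card = (G.cliqueFinset r).card := by
    intro r
    have := G.cliqueFinset_map_of_equiv e r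
    rw [← Finset.card_map ⟨Finset.map e.toEmbedding, Finset.map_injective _⟩, ← this]
    congr!
  rw [← hcard] at h ⊢
  -- Otherwise there would be more `t`-cliques than `t`-subsets of the vertex set.
  have hkn : k ≤ Fintype.card V := by
    by_contra! hlt
    have h1 := h.trans SimpleGraph.card_cliqueFinset_le
    rw [Fintype.card_fin] at h1
    have h2 : (Fintype.card V).choose t < (Fintype.card V + 1).choose t ∨
        (Fintype.card V).choose t = 0 := by
      obtain ⟨r, rfl⟩ : ∃ r, t = r + 1 := ⟨t - 1, by omega⟩
      rw [Nat.choose_succ_succ']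
      rcases Nat.lt_or_ge (Fintype.card V) (r + 1) with h3 | h3
      · exact Or.inr (Nat.choose_eq_zero_of_lt h3)
      · have := Nat.choose_pos (n := Fintype.card V) (k := r) (by omega)
        left; omega
    rcases h2 with h2 | h2
    · exact absurd (h2.trans_le (Nat.choose_le_choose t hlt)) (not_lt.2 h1)
    · have := Nat.choose_pos htk; omega
  have hsized : (((G.map e.toEmbedding).cliqueFinset t : Finset (Finset (Fin (Fintype.card V)))) :
      Set (Finset (Fin (Fintype.card V)))).Sized t := by
    intro S hS
    exact (SimpleGraph.mem_cliqueFinset_iff.1 (Finset.mem_coe.1 hS)).card_eq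
  have hkk := Finset.kruskal_katona_lovasz_form (i := t - s) (Nat.sub_le t s) htk hkn hsized h
  rw [Nat.sub_sub_self hst] at hkk
  refine hkk.trans (Finset.card_le_card fun S hS ↦ ?_)
  obtain ⟨T, hT, hST, hc⟩ := Finset.mem_shadow_iterate_iff_exists_mem_card_add.1 hS
  rw [SimpleGraph.mem_cliqueFinset_iff] at hT ⊢
  refine (SimpleGraph.isNClique_iff _).2 ⟨hT.isClique.subset hST, ?_⟩
  have := hT.card_eq
  omega

/-! ### Ramsey numbers: existence and upper bounds -/

/-- The Erdős–Szekeres bound. -/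
theorem exists_isNClique_or_compl {V : Type*} [DecidableEq V] (G : SimpleGraph V) (a b : ℕ)
    (S : Finset V) (hS : (a + b).choose a ≤ S.card) :
    (∃ T ⊆ S, G.IsNClique (a + 1) T) ∨ ∃ T ⊆ S, Gᶜ.IsNClique (b + 1) T := by
  classical
  induction hn : a + b generalizing a b S with
  | zero =>
    obtain ⟨rfl, rfl⟩ : a = 0 ∧ b = 0 := by omega
    obtain ⟨v, hv⟩ := Finset.card_pos.1 (show 0 < S.card by simpa using hS)
    exact Or.inl ⟨{v}, by simpa using hv, by simp [SimpleGraph.isNClique_singleton]⟩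
  | succ n ih =>
    have hpos : 0 < S.card := (Nat.choose_pos (Nat.le_add_right a b)).trans_le hS
    obtain ⟨v, hv⟩ := Finset.card_pos.1 hpos
    rcases a with - | a
    · exact Or.inl ⟨{v}, by simpa using hv, by simp [SimpleGraph.isNClique_singleton]⟩
    rcases b with - | b
    · exact Or.inr ⟨{v}, by simpa using hv, by simp [SimpleGraph.isNClique_singleton]⟩
    have hsplit := Finset.card_filter_add_card_filter_not (s := S.erase v) (fun x ↦ G.Adj v x)
    rw [Finset.card_erase_of_mem hv] at hsplit
    have hpascal : (a + 1 + (b + 1)).choose (a + 1)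
        = (a + (b + 1)).choose a + (a + 1 + b).choose (a + 1) := by
      rw [show a + 1 + (b + 1) = a + (b + 1) + 1 by ring, Nat.choose_succ_succ,
        show a + (b + 1) = a + 1 + b by ring]
    have hsub : ∀ p : V → Prop, ∀ [DecidablePred p], (S.erase v).filter p ⊆ S := fun p _ ↦
      (Finset.filter_subset _ _).trans (Finset.erase_subset _ _)
    by_cases hN : (a + (b + 1)).choose a ≤ ((S.erase v).filter (G.Adj v ·)).card
    · rcases ih a (b + 1) _ hN (by omega) with ⟨T, hT, hc⟩ | ⟨T, hT, hc⟩
      · refine Or.inl ⟨insert v T, Finset.insert_subset hv (hT.trans (hsub _)), hc.insert ?_⟩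
        exact fun x hx ↦ (Finset.mem_filter.1 (hT hx)).2
      · exact Or.inr ⟨T, hT.trans (hsub _), hc⟩
    · have hM : (a + 1 + b).choose (a + 1) ≤ ((S.erase v).filter (¬ G.Adj v ·)).card := by omega
      rcases ih (a + 1) b _ hM (by omega) with ⟨T, hT, hc⟩ | ⟨T, hT, hc⟩
      · exact Or.inl ⟨T, hT.trans (hsub _), hc⟩
      · refine Or.inr ⟨insert v T, Finset.insert_subset hv (hT.trans (hsub _)), hc.insert ?_⟩
        intro x hx
        have hx' := Finset.mem_filter.1 (hT hx)
        exact (SimpleGraph.compl_adj _ _ _).2 ⟨(Finset.ne_of_mem_erase hx'.1).symm, hx'.2⟩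

theorem isRamseyGraph_completeGraph (a b : ℕ) :
    IsRamseyGraph (SimpleGraph.completeGraph (Fin ((a + b).choose a))) (a + 1) (b + 1) := by
  intro C
  rcases exists_isNClique_or_compl (C.labelGraph true) a b Finset.univ (by simp) with
    ⟨T, -, hT⟩ | ⟨T, -, hT⟩
  · exact Or.inl hT.not_cliqueFree
  · refine Or.inr (hT.mono ?_).not_cliqueFree
    intro x y hxy
    rw [SimpleGraph.compl_adj, SimpleGraph.EdgeLabeling.labelGraph_adj] at hxy
    rw [SimpleGraph.EdgeLabeling.labelGraph_adj]
    refine ⟨(SimpleGraph.top_adj x y).2 hxy.1, ?_⟩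
    exact Bool.eq_false_iff.2 fun h ↦ hxy.2 ⟨_, h⟩

/-- Erdős–Szekeres makes the defining set nonempty, so `sInf` is attained and is not the default
value 0. -/
theorem isRamseyGraph_ramseyNumber {t : ℕ} (ht : 0 < t) :
    IsRamseyGraph (SimpleGraph.completeGraph (Fin (ramseyNumber 4 t))) 4 t := by
  obtain ⟨b, rfl⟩ : ∃ b, t = b + 1 := ⟨t - 1, by omega⟩
  exact Nat.sInf_mem (s := {n : ℕ | IsRamseyGraph (SimpleGraph.completeGraph (Fin n)) 4 (b + 1)})
    ⟨_, isRamseyGraph_completeGraph 3 b⟩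

theorem ramseyNumber_four_le {t : ℕ} (ht : 0 < t) : ramseyNumber 4 t ≤ (t + 2) ^ 3 := by
  obtain ⟨b, rfl⟩ : ∃ b, t = b + 1 := ⟨t - 1, by omega⟩
  calc ramseyNumber 4 (b + 1) ≤ (3 + b).choose 3 := Nat.sInf_le (isRamseyGraph_completeGraph 3 b)
    _ ≤ (3 + b) ^ 3 := Nat.choose_le_pow _ _
    _ = _ := by ring

theorem card_cliqueFinset_completeGraph (n s : ℕ) :
    ((SimpleGraph.completeGraph (Fin n)).cliqueFinset s).card = n.choose s := by
  have h := Finset.card_powersetCard s (Finset.univ : Finset (Fin n))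
  rw [Finset.card_univ, Fintype.card_fin] at h
  rw [← h]
  congr 1
  ext S
  rw [SimpleGraph.mem_cliqueFinset_iff, SimpleGraph.isNClique_iff, Finset.mem_powersetCard]
  simp [SimpleGraph.IsClique.top]

theorem graphRamseyNumber_completeGraph_le {t : ℕ} (ht : 0 < t) (s : ℕ) :
    graphRamseyNumber (SimpleGraph.completeGraph (Fin s)) 4 t ≤ (ramseyNumber 4 t).choose s :=
  Nat.sInf_le ⟨_, _, isRamseyGraph_ramseyNumber ht, by
    rw [copyCount_completeGraph, card_cliqueFinset_completeGraph]⟩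

theorem exists_copyCount_eq_graphRamseyNumber {t : ℕ} (ht : 0 < t) (s : ℕ) :
    ∃ (n : ℕ) (G : SimpleGraph (Fin n)), IsRamseyGraph G 4 t ∧
      G.copyCount (SimpleGraph.completeGraph (Fin s))
        = graphRamseyNumber (SimpleGraph.completeGraph (Fin s)) 4 t :=
  Nat.sInf_mem (s := {N : ℕ | ∃ (n : ℕ) (G : SimpleGraph (Fin n)), IsRamseyGraph G 4 t ∧
    G.copyCount (SimpleGraph.completeGraph (Fin s)) = N})
    ⟨_, _, _, isRamseyGraph_ramseyNumber ht, rfl⟩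

/-! ### The choice of parameters -/

/-- In `hk`, `128 = 64 * 2`, the 2 coming from `n ≥ q^4 / 2`; in `647 = 1 + 1 + 645` the terms come
from `binom(k,t) ≤ (ek/t)^t`, from `exp t`, and from `(n + 1)^R`. -/
theorem choose_le_card_cliqueFinset_of_isRamseyGraph {q t k : ℕ} [Fact q.Prime] (hq : 3 ≤ q)
    (hsmall : (q : ℝ) ^ 4 * (1 / 2) ^ ((q + 1) / 2) ≤ 1) (ht0 : 0 < t)
    (ht : (t : ℝ) ≤ 64 * (q : ℝ) ^ 2) (hlog : (q : ℝ) * Real.log q ^ 2 ≤ t)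
    (hk : (k : ℝ) * (128 * Real.exp 647) ≤ t * (q : ℝ) ^ 2)
    {V : Type*} [Fintype V] [DecidableEq V] (G : SimpleGraph V) [DecidableRel G.Adj]
    (hG : IsRamseyGraph G 4 t) : k.choose t ≤ (G.cliqueFinset t).card := by
  obtain ⟨P, L, _, _, _, _, inc, hinc, hP, hLlow, hLup⟩ := exists_isONanFree q
  by_contra! hlt
  set n := Fintype.card L with hn
  have hq' : (3 : ℝ) ≤ q := by exact_mod_cast hq
  have hq0 : (0 : ℝ) < q := by linarith
  have hlq : 1 ≤ Real.log q := by
    rw [Real.le_log_iff_exp_le hq0]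
    linarith [Real.exp_one_lt_d9]
  have hnup : (n : ℝ) ≤ (q : ℝ) ^ 4 := by exact_mod_cast hLup
  have hnlow : (q : ℝ) ^ 4 / 2 ≤ n := by
    have h1 : (q : ℝ) ^ 4 ≤ n + (q : ℝ) ^ 3 := by exact_mod_cast hLlow
    have h2 : 2 * (q : ℝ) ^ 3 ≤ (q : ℝ) ^ 4 := by
      rw [pow_succ (q : ℝ) 3, mul_comm]
      exact mul_le_mul_of_nonneg_left (by linarith) (by positivity)
    linarith
  have hn0 : (0 : ℝ) < n := lt_of_lt_of_le (by positivity) hnlow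
  -- So many drops by `1 - 1/(64q)` gain a factor `q^2`, bringing the initial mass `n ≤ q^4` below
  -- the threshold.
  set R := ⌈128 * (q : ℝ) * Real.log q⌉₊ with hR
  have hR1 : 128 * (q : ℝ) * Real.log q ≤ R := Nat.le_ceil _
  have hR2 : (R : ℝ) ≤ 129 * (q : ℝ) * Real.log q := by
    have := (Nat.ceil_lt_add_one (a := 128 * (q : ℝ) * Real.log q) (by positivity)).le
    nlinarith
  have hRm : (n : ℝ) * (1 - 1 / (64 * q)) ^ R ≤ 64 * (q : ℝ) ^ 2 := by
    have h1 : (1 - 1 / (64 * (q : ℝ))) ^ R ≤ 1 / (q : ℝ) ^ 2 := by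
      calc _ ≤ (Real.exp (-(1 / (64 * (q : ℝ))))) ^ R := by
            refine pow_le_pow_left₀ ?_ (by linarith [Real.add_one_le_exp (-(1 / (64 * (q : ℝ))))]) R
            rw [sub_nonneg, div_le_one (by positivity)]; linarith
        _ = Real.exp (-(R / (64 * (q : ℝ)))) := by
            rw [← Real.exp_nat_mul]; congr 1; ring
        _ ≤ Real.exp (-(2 * Real.log q)) := by
            refine Real.exp_le_exp.2 (neg_le_neg ?_)
            rw [le_div_iff₀ (by positivity)]; linarith
        _ = 1 / (q : ℝ) ^ 2 := by
            rw [Real.exp_neg, one_div, ← Nat.cast_ofNat, Real.exp_nat_mul, Real.exp_log hq0]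
    calc _ ≤ (q : ℝ) ^ 4 * (1 / (q : ℝ) ^ 2) :=
          mul_le_mul hnup h1 (pow_nonneg (by
            rw [sub_nonneg, div_le_one (by positivity)]; linarith) R) (by positivity)
      _ = (q : ℝ) ^ 2 := by field_simp
      _ ≤ _ := by nlinarith [sq_nonneg (q : ℝ)]
  have hRn : ((n : ℝ) + 1) ^ R ≤ Real.exp 645 ^ t := by
    have h1 : (n : ℝ) + 1 ≤ Real.exp (5 * Real.log q) := by
      have : Real.exp (5 * Real.log q) = (q : ℝ) ^ 5 := by
        rw [← Nat.cast_ofNat, Real.exp_nat_mul, Real.exp_log hq0]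
      rw [this]
      have h4 : 1 ≤ (q : ℝ) ^ 4 := one_le_pow₀ (by linarith)
      calc (n : ℝ) + 1 ≤ (q : ℝ) ^ 4 * 2 := by linarith
        _ ≤ (q : ℝ) ^ 4 * q := mul_le_mul_of_nonneg_left (by linarith) (by positivity)
        _ = _ := by ring
    calc _ ≤ Real.exp (5 * Real.log q) ^ R := pow_le_pow_left₀ (by positivity) h1 R
      _ = Real.exp (R * (5 * Real.log q)) := by rw [Real.exp_nat_mul]
      _ ≤ Real.exp (t * 645) := by
          refine Real.exp_le_exp.2 ?_
          calc (R : ℝ) * (5 * Real.log q) ≤ 129 * (q : ℝ) * Real.log q * (5 * Real.log q) :=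
                mul_le_mul_of_nonneg_right hR2 (by linarith)
            _ = 645 * ((q : ℝ) * Real.log q ^ 2) := by ring
            _ ≤ _ := by linarith
      _ = _ := Real.exp_nat_mul _ _
  have hL' : (n : ℝ) * (1 / 2) ^ ((q + 1) / 2) ≤ 1 :=
    (mul_le_mul_of_nonneg_right hnup (by positivity)).trans hsmall
  set B := (64 * (q : ℝ) ^ 2) ^ t * (Real.exp t * ((n : ℝ) + 1) ^ R) with hB
  have hB0 : 0 < B := by positivity
  refine not_isRamseyGraph_of_card_lt hinc G (by exact_mod_cast hn0) (B := B) ?_ ?_ hG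
  · intro T hT
    exact sum_setWeight_image_le (by omega) hinc hP hL' (by rw [Fintype.card_coe, hT]) ht0 ht hRm
  · have ht0' : (0 : ℝ) < t := by exact_mod_cast ht0
    have hchoose : (k.choose t : ℝ) ≤ ((k : ℝ) * Real.exp 1 / t) ^ t := by
      have h1 := Nat.choose_le_pow_div (α := ℝ) t k
      have h2 := Real.pow_div_factorial_le_exp (t : ℝ) ht0'.le t
      have hf : (0 : ℝ) < t.factorial := by exact_mod_cast t.factorial_pos
      rw [div_pow, mul_pow, ← Real.exp_nat_mul, mul_one]
      refine h1.trans ?_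
      rw [div_le_div_iff₀ hf (by positivity)]
      rw [div_le_iff₀ hf] at h2
      calc (k : ℝ) ^ t * (t : ℝ) ^ t ≤ (k : ℝ) ^ t * (Real.exp t * t.factorial) :=
            mul_le_mul_of_nonneg_left h2 (by positivity)
        _ = _ := by ring
    calc ((G.cliqueFinset t).card : ℝ) * B < (k.choose t : ℝ) * B :=
          mul_lt_mul_of_pos_right (by exact_mod_cast hlt) hB0
      _ ≤ ((k : ℝ) * Real.exp 1 / t) ^ t * ((64 * (q : ℝ) ^ 2) ^ t *
            (Real.exp 1 ^ t * Real.exp 645 ^ t)) := by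
          rw [hB, ← Real.exp_nat_mul 1 t, mul_one]
          gcongr
      _ = ((k : ℝ) * (128 * Real.exp 647) * (q : ℝ) ^ 2 / (2 * t)) ^ t := by
          rw [← mul_pow, ← mul_pow, ← mul_pow]
          congr 1
          rw [show (647 : ℝ) = 1 + 1 + 645 by norm_num, Real.exp_add, Real.exp_add]
          field_simp
          ring
      _ ≤ (n : ℝ) ^ t := by
          refine pow_le_pow_left₀ (by positivity) ?_ t
          refine le_trans ?_ hnlow
          rw [div_le_div_iff₀ (by positivity) (by norm_num)]
          nlinarith [mul_le_mul_of_nonneg_right hk (sq_nonneg (q : ℝ))]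

theorem exists_forall_log_pow_le {η : ℝ} (hη : 0 < η) :
    ∃ T : ℕ, ∀ t : ℕ, T ≤ t → 1 ≤ Real.log t ∧ Real.log t ^ 4 ≤ η * t := by
  have h1 : ∀ᶠ x : ℝ in Filter.atTop, 1 ≤ Real.log x :=
    Real.tendsto_log_atTop.eventually_ge_atTop 1
  have h2 := (Real.isLittleO_pow_log_id_atTop (n := 4)).bound hη
  have h3 := tendsto_natCast_atTop_atTop (R := ℝ) |>.eventually (h1.and h2)
  obtain ⟨T, hT⟩ := Filter.eventually_atTop.1 h3
  refine ⟨T, fun t ht ↦ ⟨(hT t ht).1, ?_⟩⟩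
  have := (hT t ht).2
  simp only [id, Real.norm_eq_abs, Nat.abs_cast] at this
  exact (le_abs_self _).trans this

theorem exists_forall_pow_mul_half_pow_le :
    ∃ Q : ℕ, ∀ q : ℕ, Q ≤ q → (q : ℝ) ^ 4 * (1 / 2) ^ ((q + 1) / 2) ≤ 1 := by
  have h := tendsto_pow_const_mul_const_pow_of_lt_one 4 (r := (3 / 4 : ℝ)) (by norm_num)
    (by norm_num)
  obtain ⟨Q, hQ⟩ := Filter.eventually_atTop.1 (h.eventually_le_const (show (0 : ℝ) < 1 by norm_num))
  refine ⟨Q, fun q hq ↦ le_trans (mul_le_mul_of_nonneg_left ?_ (by positivity)) (hQ q hq)⟩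
  -- Since `1/2 ≤ (3/4)^2`, the halved exponent is absorbed into a geometric sequence in `q`.
  calc (1 / 2 : ℝ) ^ ((q + 1) / 2) ≤ ((3 / 4) ^ 2) ^ ((q + 1) / 2) :=
        pow_le_pow_left₀ (by norm_num) (by norm_num) _
    _ = (3 / 4) ^ (2 * ((q + 1) / 2)) := by rw [pow_mul]
    _ ≤ _ := pow_le_pow_of_le_one (by norm_num) (by norm_num) (by omega)

/-- For large `t` there are a prime `q` and a number `k` as needed for the lower bound. -/
theorem exists_parameters : ∃ c : ℝ, 0 < c ∧ c ≤ 1 ∧ ∃ T : ℕ, ∀ t : ℕ, T ≤ t →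
    1 ≤ Real.log t ∧ (t : ℝ) ^ 2 ≤ c * ((t : ℝ) ^ 3 / Real.log t ^ 4) / 2 ∧
    ∃ q k : ℕ, q.Prime ∧ 3 ≤ q ∧ (q : ℝ) ^ 4 * (1 / 2) ^ ((q + 1) / 2) ≤ 1 ∧
      (t : ℝ) ≤ 64 * (q : ℝ) ^ 2 ∧ (q : ℝ) * Real.log q ^ 2 ≤ t ∧
      (k : ℝ) * (128 * Real.exp 647) ≤ t * (q : ℝ) ^ 2 ∧
      c * ((t : ℝ) ^ 3 / Real.log t ^ 4) ≤ k := by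
  obtain ⟨Q, hQ⟩ := exists_forall_pow_mul_half_pow_le
  -- Here `1024 = 128 * 2 * 4`: 2 for rounding up `k`, 4 from `q ≥ t / (2 log^2 t)`.
  set c : ℝ := Real.exp (-647) / 1024 with hc
  have hc0 : 0 < c := by positivity
  have hc1 : c ≤ 1 := by
    have : Real.exp (-647) ≤ 1 := Real.exp_le_one_iff.2 (by norm_num)
    rw [hc]; linarith
  set η : ℝ := min (1 / (2 * ((Q : ℝ) + 3))) (c / 2) with hη
  have hη0 : 0 < η := by positivity
  obtain ⟨T, hT⟩ := exists_forall_log_pow_le hη0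
  refine ⟨c, hc0, hc1, max T 1, fun t ht ↦ ?_⟩
  obtain ⟨hl1, hl4⟩ := hT t (le_of_max_le_left ht)
  have ht1 : (1 : ℝ) ≤ t := by exact_mod_cast le_of_max_le_right ht
  set l := Real.log t with hl
  have hl0 : 0 < l := by linarith
  have hl2 : l ^ 2 ≤ l ^ 4 := pow_le_pow_right₀ hl1 (by norm_num)
  have hl4a : l ^ 4 * (2 * ((Q : ℝ) + 3)) ≤ t := by
    have : l ^ 4 ≤ 1 / (2 * ((Q : ℝ) + 3)) * t :=
      hl4.trans (mul_le_mul_of_nonneg_right (min_le_left _ _) (by linarith))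
    rwa [one_div_mul_eq_div, le_div_iff₀ (by positivity)] at this
  have hl4b : l ^ 4 ≤ c / 2 * t :=
    hl4.trans (mul_le_mul_of_nonneg_right (min_le_right _ _) (by linarith))
  have hX : (t : ℝ) ^ 2 ≤ c * ((t : ℝ) ^ 3 / l ^ 4) / 2 := by
    rw [mul_div_assoc', le_div_iff₀ (by norm_num), le_div_iff₀ (by positivity)]
    nlinarith [sq_nonneg (t : ℝ)]
  refine ⟨hl1, hX, ?_⟩
  set y := (t : ℝ) / (2 * l ^ 2) with hy
  have hyQ : (Q : ℝ) + 3 ≤ y := by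
    rw [hy, le_div_iff₀ (by positivity)]
    have hQ0 : (0 : ℝ) ≤ Q := Nat.cast_nonneg Q
    nlinarith
  have hfl : Q + 3 ≤ ⌊y⌋₊ := Nat.le_floor (by push_cast; exact hyQ)
  -- Bertrand's postulate gives a prime between `t / (2 log^2 t)` and `t / log^2 t`.
  obtain ⟨q, hq, hq1, hq2⟩ := Nat.exists_prime_lt_and_le_two_mul ⌊y⌋₊ (by omega)
  have hyq : y ≤ q := by
    have h1 := (Nat.lt_floor_add_one y).le
    have h2 : ((⌊y⌋₊ : ℕ) : ℝ) + 1 ≤ q := by exact_mod_cast hq1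
    linarith
  have hqy : (q : ℝ) ≤ 2 * y := by
    have h1 := Nat.floor_le (show 0 ≤ y by positivity)
    have h2 : (q : ℝ) ≤ 2 * (⌊y⌋₊ : ℝ) := by exact_mod_cast hq2
    linarith
  have hq0 : (0 : ℝ) < q := by exact_mod_cast hq.pos
  have hqt : (q : ℝ) * l ^ 2 ≤ t := by
    have : 2 * y * l ^ 2 = t := by rw [hy]; field_simp
    nlinarith [sq_nonneg l]
  have hqt' : (q : ℝ) ≤ t :=
    (le_mul_of_one_le_right hq0.le (one_le_pow₀ hl1)).trans hqt
  have hy2 : (t : ℝ) ^ 2 / (4 * l ^ 4) ≤ (q : ℝ) ^ 2 := by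
    calc _ = y ^ 2 := by rw [hy]; field_simp; norm_num
      _ ≤ _ := pow_le_pow_left₀ (by positivity) hyq 2
  refine ⟨q, ⌈c * ((t : ℝ) ^ 3 / l ^ 4)⌉₊, hq, by omega, hQ q (by omega), ?_, ?_, ?_, Nat.le_ceil _⟩
  · refine le_trans ?_ (mul_le_mul_of_nonneg_left hy2 (by norm_num))
    rw [mul_div_assoc', le_div_iff₀ (by positivity)]
    nlinarith
  · refine le_trans (mul_le_mul_of_nonneg_left (pow_le_pow_left₀ ?_ (Real.log_le_log hq0 hqt') 2)
      hq0.le) hqt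
    exact Real.log_nonneg (by exact_mod_cast hq.one_le)
  · have h1 : ((⌈c * ((t : ℝ) ^ 3 / l ^ 4)⌉₊ : ℕ) : ℝ) ≤ 2 * (c * ((t : ℝ) ^ 3 / l ^ 4)) := by
      have := (Nat.ceil_lt_add_one (a := c * ((t : ℝ) ^ 3 / l ^ 4)) (by positivity)).le
      nlinarith
    calc _ ≤ 2 * (c * ((t : ℝ) ^ 3 / l ^ 4)) * (128 * Real.exp 647) :=
          mul_le_mul_of_nonneg_right h1 (by positivity)
      _ = (t : ℝ) * (t ^ 2 / (4 * l ^ 4)) := by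
          rw [hc, Real.exp_neg]; field_simp; norm_num
      _ ≤ _ := mul_le_mul_of_nonneg_left hy2 (by linarith)

/-! ### Generalized binomial coefficients -/

theorem ring_choose_eq_prod (x : ℝ) (s : ℕ) :
    Ring.choose x s = (∏ j ∈ Finset.range s, (x - j)) / s.factorial := by
  have h := Ring.descPochhammer_eq_factorial_smul_choose x s
  rw [← descPochhammer_eval_eq_prod_range, eq_div_iff (by exact_mod_cast s.factorial_ne_zero),
    mul_comm, ← nsmul_eq_mul, ← h, Polynomial.eval_eq_smeval]
  rw [← descPochhammer_map (Int.castRingHom ℝ), ← Polynomial.eval_eq_smeval, Polynomial.eval_map]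
  rw [Polynomial.smeval_eq_sum, Polynomial.eval₂_eq_sum]
  exact Finset.sum_congr rfl fun e _ ↦ zsmul_eq_mul _ _

theorem continuous_ring_choose (s : ℕ) : Continuous fun x : ℝ ↦ Ring.choose x s := by
  simp only [ring_choose_eq_prod]
  fun_prop

theorem ring_choose_le_ring_choose {x y : ℝ} {s : ℕ} (hs : (s : ℝ) ≤ x) (hxy : x ≤ y) :
    Ring.choose x s ≤ Ring.choose y s := by
  rw [ring_choose_eq_prod, ring_choose_eq_prod]
  refine div_le_div_of_nonneg_right (Finset.prod_le_prod (fun j hj ↦ ?_) fun j _ ↦ by linarith)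
    (Nat.cast_nonneg _)
  have : (j : ℝ) ≤ s := by exact_mod_cast (Finset.mem_range.1 hj).le
  linarith

/-- Intermediate value theorem: the polynomial is continuous and exceeds `N` at a large integer,
which needs `s > 0`. -/
theorem exists_ring_choose_eq {x₀ : ℝ} {s N : ℕ} (hs : 0 < s)
    (hN : Ring.choose x₀ s ≤ (N : ℝ)) : ∃ x, x₀ ≤ x ∧ (N : ℝ) = Ring.choose x s := by
  set M := ⌈x₀⌉₊ + (N + s) with hM
  have hxM : x₀ ≤ (M : ℝ) := (Nat.le_ceil x₀).trans (by exact_mod_cast Nat.le_add_right _ _)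
  have hNM : (N : ℝ) ≤ Ring.choose (M : ℝ) s := by
    rw [Ring.choose_natCast]
    have h1 : (N + 1).choose N ≤ (N + s).choose N := Nat.choose_le_choose N (by omega)
    rw [Nat.choose_succ_self_right, Nat.choose_symm_add] at h1
    have h2 : (N + s).choose s ≤ M.choose s := Nat.choose_le_choose s (by omega)
    exact_mod_cast (Nat.le_succ N).trans (h1.trans h2)
  obtain ⟨x, hx, hxN⟩ := intermediate_value_Icc hxM (continuous_ring_choose s).continuousOn
    ⟨hN, hNM⟩
  exact ⟨x, hx.1, hxN.symm⟩

/-! ### The exponent -/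

theorem tendsto_log_log_div_log (a : ℝ) :
    Filter.Tendsto (fun t : ℕ ↦ (a + 4 * Real.log (Real.log t)) / Real.log t) Filter.atTop
      (nhds 0) := by
  have h0 : Filter.Tendsto (fun t : ℕ ↦ Real.log t) Filter.atTop Filter.atTop :=
    Real.tendsto_log_atTop.comp tendsto_natCast_atTop_atTop
  have h1 : Filter.Tendsto (fun x : ℝ ↦ (a + 4 * Real.log x) / x) Filter.atTop (nhds 0) := by
    have h2 : Filter.Tendsto (fun x : ℝ ↦ Real.log x / x) Filter.atTop (nhds 0) :=
      Real.isLittleO_log_id_atTop.tendsto_div_nhds_zero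
    have h3 := (tendsto_const_nhds (x := a)).div_atTop Filter.tendsto_id |>.add (h2.const_mul 4)
    rw [mul_zero, add_zero] at h3
    refine h3.congr fun x ↦ ?_
    simp only [id]; ring
  exact h1.comp h0

theorem choose_le_mul_choose {k r s : ℕ} (hsk : 2 * s ≤ k) {β : ℝ} (hβ : 2 * (r : ℝ) ≤ β * k) :
    (r.choose s : ℝ) ≤ β ^ s * k.choose s := by
  rcases Nat.eq_zero_or_pos s with rfl | hs
  · simp
  have hk : (0 : ℝ) < k := by exact_mod_cast (by omega : 0 < k)
  have hβ0 : 0 ≤ β := by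
    by_contra! h
    have := mul_neg_of_neg_of_pos h hk
    linarith [Nat.cast_nonneg (α := ℝ) r]
  have hf : (0 : ℝ) < s.factorial := by exact_mod_cast s.factorial_pos
  have h1 : (k : ℝ) / 2 ≤ ((k + 1 - s : ℕ) : ℝ) := by
    rw [div_le_iff₀ (by norm_num)]
    exact_mod_cast (by omega : k ≤ (k + 1 - s) * 2)
  calc (r.choose s : ℝ) ≤ (r : ℝ) ^ s / s.factorial := Nat.choose_le_pow_div s r
    _ ≤ (β * (k / 2)) ^ s / s.factorial := by
        refine div_le_div_of_nonneg_right (pow_le_pow_left₀ (Nat.cast_nonneg r) ?_ s) hf.le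
        linarith
    _ = β ^ s * ((k / 2 : ℝ) ^ s / s.factorial) := by rw [mul_pow, mul_div_assoc]
    _ ≤ β ^ s * (((k + 1 - s : ℕ) : ℝ) ^ s / s.factorial) := by gcongr
    _ ≤ _ := mul_le_mul_of_nonneg_left (Nat.pow_le_choose s k) (by positivity)

/-- Makes the logarithm of the binomial coefficient at least `s * log t`, so the error in the
exponent is uniform in `s`. -/
theorem pow_le_choose_of_sq_le {k s t : ℕ} (hst : s ≤ t) (hk : 2 * t ^ 2 ≤ k) :
    (t : ℝ) ^ s ≤ k.choose s := by
  rcases Nat.eq_zero_or_pos s with rfl | hs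
  · simp
  have hf : (0 : ℝ) < s.factorial := by exact_mod_cast s.factorial_pos
  have h1 : t * s ≤ k + 1 - s := by
    have h2 : t * s ≤ t ^ 2 := by rw [sq]; exact Nat.mul_le_mul_left t hst
    have h3 : t ≤ t ^ 2 := Nat.le_self_pow two_ne_zero t
    omega
  refine le_trans ?_ (Nat.pow_le_choose s k)
  rw [le_div_iff₀ hf]
  calc (t : ℝ) ^ s * s.factorial ≤ (t : ℝ) ^ s * (s : ℝ) ^ s := by
        gcongr; exact_mod_cast Nat.factorial_le_pow s
    _ = ((t * s : ℕ) : ℝ) ^ s := by push_cast; rw [mul_pow]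
    _ ≤ _ := by gcongr

/-- A number that is not much smaller than `C` is a power of `C` with exponent close to one. -/
theorem exists_eq_rpow_one_sub {s : ℕ} {N C β τ : ℝ} (hs : 0 < s) (hτ1 : 1 < τ)
    (hN : 1 ≤ N) (hNC : N ≤ C) (hCN : C ≤ β ^ s * N) (hτC : τ ^ s ≤ C) (hβ : 1 ≤ β) :
    ∃ ε : ℝ, 0 ≤ ε ∧ ε ≤ Real.log β / Real.log τ ∧ N = C ^ (1 - ε) := by
  have hs' : (0 : ℝ) < s := by exact_mod_cast hs
  have hC0 : 0 < C := by linarith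
  have hN0 : 0 < N := by linarith
  have hτ : 0 < Real.log τ := Real.log_pos hτ1
  have hτ0 : 0 < τ ^ s := by positivity
  have hlog : s * Real.log τ ≤ Real.log C := by
    rw [← Real.log_pow]; exact Real.log_le_log hτ0 hτC
  have hlC : 0 < Real.log C := lt_of_lt_of_le (mul_pos hs' hτ) hlog
  have hdiff : Real.log C - Real.log N ≤ s * Real.log β := by
    have h1 := Real.log_le_log hC0 hCN
    rw [Real.log_mul (by positivity) hN0.ne', Real.log_pow] at h1
    linarith
  have hlNC : Real.log N ≤ Real.log C := Real.log_le_log hN0 hNC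
  -- The numerator is at most `s * log β` and the denominator at least `s * log τ`; the factor `s`
  -- cancels.
  refine ⟨(Real.log C - Real.log N) / Real.log C, div_nonneg (by linarith) hlC.le, ?_, ?_⟩
  · rw [div_le_div_iff₀ hlC hτ]
    calc _ ≤ s * Real.log β * Real.log τ := mul_le_mul_of_nonneg_right hdiff hτ.le
      _ = Real.log β * (s * Real.log τ) := by ring
      _ ≤ _ := mul_le_mul_of_nonneg_left hlog (Real.log_nonneg hβ)
  · have h1 : 1 - (Real.log C - Real.log N) / Real.log C = Real.log N / Real.log C := by
      field_simp; ring
    rw [h1, Real.rpow_def_of_pos hC0, mul_div_cancel₀ _ hlC.ne', Real.exp_log hN0]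

/-! ### The main theorem -/

theorem choose_le_copyCount_of_isRamseyGraph {q t k s : ℕ} (hp : q.Prime) (hq : 3 ≤ q)
    (hsmall : (q : ℝ) ^ 4 * (1 / 2) ^ ((q + 1) / 2) ≤ 1) (ht0 : 0 < t)
    (ht : (t : ℝ) ≤ 64 * (q : ℝ) ^ 2) (hlog : (q : ℝ) * Real.log q ^ 2 ≤ t)
    (hk : (k : ℝ) * (128 * Real.exp 647) ≤ t * (q : ℝ) ^ 2) (hst : s ≤ t) (htk : t ≤ k)
    {V : Type*} [Fintype V] (G : SimpleGraph V) (hG : IsRamseyGraph G 4 t) :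
    k.choose s ≤ G.copyCount (SimpleGraph.completeGraph (Fin s)) := by
  classical
  have := Fact.mk hp
  rw [copyCount_completeGraph]
  exact choose_le_card_cliqueFinset G hst ht0 htk
    (choose_le_card_cliqueFinset_of_isRamseyGraph hq hsmall ht0 ht hlog hk G hG)

theorem mainTheorem1 :
    (∃ c : ℝ, 0 < c ∧ ∃ T : ℕ, ∀ t : ℕ, T ≤ t → ∀ s : ℕ, s ≤ t →
      (∀ (V : Type*) [Fintype V] (G : SimpleGraph V), IsRamseyGraph G 4 t →
        Ring.choose (c * ((t : ℝ) ^ 3 / Real.log t ^ 4)) s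
          ≤ (G.copyCount (SimpleGraph.completeGraph (Fin s)) : ℝ)) ∧
      ∃ x : ℝ, c * ((t : ℝ) ^ 3 / Real.log t ^ 4) ≤ x ∧
        (graphRamseyNumber (SimpleGraph.completeGraph (Fin s)) 4 t : ℝ) = Ring.choose x s) ∧
    (∃ δ : ℕ → ℝ, Filter.Tendsto δ Filter.atTop (nhds 0) ∧
      ∃ T : ℕ, ∀ t : ℕ, T ≤ t → ∀ s : ℕ, s ≤ t →
        ∃ ε : ℝ, 0 ≤ ε ∧ ε ≤ δ t ∧
          (graphRamseyNumber (SimpleGraph.completeGraph (Fin s)) 4 t : ℝ)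
            = ((ramseyNumber 4 t).choose s : ℝ) ^ (1 - ε)) := by
  obtain ⟨c, hc0, hc1, T, hT⟩ := exists_parameters
  have ht1 : ∀ t : ℕ, 1 ≤ Real.log t → 0 < t := by
    intro t h
    rcases Nat.eq_zero_or_pos t with rfl | h0
    · norm_num at h
    · exact h0
  have hX2 : ∀ {t : ℕ}, 0 < t → (t : ℝ) ^ 2 ≤ c * ((t : ℝ) ^ 3 / Real.log t ^ 4) / 2 →
      (t : ℝ) ≤ c * ((t : ℝ) ^ 3 / Real.log t ^ 4) := by
    intro t ht0 h
    have : (1 : ℝ) ≤ t := by exact_mod_cast ht0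
    nlinarith
  refine ⟨⟨c, hc0, T, fun t htT s hst ↦ ?_⟩, fun t ↦ (Real.log (54 / c) + 4 * Real.log (Real.log t))
    / Real.log t, tendsto_log_log_div_log _, T, fun t htT s hst ↦ ?_⟩
  · obtain ⟨hl, hX, q, k, hp, hq, hsmall, ht, hlog, hk, hck⟩ := hT t htT
    have ht0 := ht1 t hl
    have htX := hX2 ht0 hX
    have hsX : (s : ℝ) ≤ c * ((t : ℝ) ^ 3 / Real.log t ^ 4) :=
      le_trans (by exact_mod_cast hst) htX
    have htk : t ≤ k := by exact_mod_cast htX.trans hck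
    have hXk : Ring.choose (c * ((t : ℝ) ^ 3 / Real.log t ^ 4)) s ≤ (k.choose s : ℝ) := by
      rw [← Ring.choose_natCast]; exact ring_choose_le_ring_choose hsX hck
    constructor
    · intro V _ G hG
      exact hXk.trans (by exact_mod_cast
        choose_le_copyCount_of_isRamseyGraph hp hq hsmall ht0 ht hlog hk hst htk G hG)
    · obtain ⟨n, G, hG, hN⟩ := exists_copyCount_eq_graphRamseyNumber ht0 s
      -- For `s = 0` both sides equal 1 for every `x`.
      rcases Nat.eq_zero_or_pos s with rfl | hs
      · refine ⟨_, le_rfl, ?_⟩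
        rw [← hN, SimpleGraph.copyCount_of_isEmpty, Ring.choose_zero_right, Nat.cast_one]
      · refine exists_ring_choose_eq hs (hXk.trans ?_)
        rw [← hN]
        exact_mod_cast
          choose_le_copyCount_of_isRamseyGraph hp hq hsmall ht0 ht hlog hk hst htk G hG
  · obtain ⟨hl, hX, q, k, hp, hq, hsmall, ht, hlog, hk, hck⟩ := hT t htT
    have ht0 := ht1 t hl
    have ht0' : (1 : ℝ) ≤ t := by exact_mod_cast ht0
    have hl0 : 0 < Real.log t := by linarith
    have htk : t ≤ k := by exact_mod_cast (hX2 ht0 hX).trans hck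
    obtain ⟨n, G, hG, hN⟩ := exists_copyCount_eq_graphRamseyNumber ht0 s
    have hkN : k.choose s ≤ graphRamseyNumber (SimpleGraph.completeGraph (Fin s)) 4 t := by
      rw [← hN]
      exact choose_le_copyCount_of_isRamseyGraph hp hq hsmall ht0 ht hlog hk hst htk G hG
    have hNr := graphRamseyNumber_completeGraph_le ht0 s
    have hc54 : 1 ≤ 54 / c := by rw [le_div_iff₀ hc0]; linarith
    rcases Nat.eq_zero_or_pos s with rfl | hs
    · refine ⟨0, le_rfl, div_nonneg (add_nonneg (Real.log_nonneg hc54)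
        (mul_nonneg (by norm_num) (Real.log_nonneg hl))) hl0.le, ?_⟩
      rw [← hN, SimpleGraph.copyCount_of_isEmpty]; simp
    -- `54 = 2 * 3^3`: `r(4,t) ≤ (t + 2)^3 ≤ (3t)^3`, and the 2 is the one required by
    -- `choose_le_mul_choose`.
    set β := 54 / c * Real.log t ^ 4 with hβ
    have hβ1 : 1 ≤ β := by
      have := one_le_pow₀ (n := 4) hl
      nlinarith
    have hlogβ : Real.log β = Real.log (54 / c) + 4 * Real.log (Real.log t) := by
      rw [hβ, Real.log_mul (by positivity) (by positivity), Real.log_pow]; norm_num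
    have hrβ : 2 * (ramseyNumber 4 t : ℝ) ≤ β * k := by
      have h1 : (ramseyNumber 4 t : ℝ) ≤ ((t : ℝ) + 2) ^ 3 := by
        exact_mod_cast ramseyNumber_four_le ht0
      have h2 : ((t : ℝ) + 2) ^ 3 ≤ (3 * (t : ℝ)) ^ 3 :=
        pow_le_pow_left₀ (by positivity) (by linarith) 3
      calc 2 * (ramseyNumber 4 t : ℝ) ≤ 54 * (t : ℝ) ^ 3 := by nlinarith
        _ = β * (c * ((t : ℝ) ^ 3 / Real.log t ^ 4)) := by rw [hβ]; field_simp
        _ ≤ β * k := mul_le_mul_of_nonneg_left hck (by linarith)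
    have hk2 : 2 * t ^ 2 ≤ k := by
      have : 2 * (t : ℝ) ^ 2 ≤ k := by linarith
      exact_mod_cast this
    have hkN' : (k.choose s : ℝ) ≤ graphRamseyNumber (SimpleGraph.completeGraph (Fin s)) 4 t := by
      exact_mod_cast hkN
    have hNr' : (graphRamseyNumber (SimpleGraph.completeGraph (Fin s)) 4 t : ℝ)
        ≤ ((ramseyNumber 4 t).choose s : ℝ) := by exact_mod_cast hNr
    have hτ1 : (1 : ℝ) < t := by
      by_contra! h
      have := Real.log_nonpos (by positivity) h
      linarith
    have hs2 : 2 * s ≤ k := by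
      have := Nat.le_self_pow two_ne_zero t
      omega
    beta_reduce
    rw [← hlogβ]
    refine exists_eq_rpow_one_sub hs hτ1 ?_ hNr' ?_ ?_ hβ1
    · refine le_trans ?_ hkN'
      exact_mod_cast Nat.choose_pos (hst.trans htk)
    · exact (choose_le_mul_choose hs2 hrβ).trans
        (mul_le_mul_of_nonneg_left hkN' (by positivity))
    · exact (pow_le_choose_of_sq_le hst hk2).trans (hkN'.trans hNr')
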